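/- Let $N$ be a finite bipartite graph, multiple edges allowed, with a nonnegative real weight on each edge, whose vertices are coloured black and white so that every edge joins a black vertex to a white one. Some of the vertices are $n$ boundary vertices $1,\dots,n$; the others are called interior. Suppose that every boundary vertex has degree one and that no edge joins two boundary vertices. Suppose also that $N$ is embedded in a closed disk, with the interior vertices in the open disk, the boundary vertices $1,\dots,n$ in clockwise order on the boundary circle, and the edges represented by simple arcs in the disk that meet vertices and one another only at their endpoints. A dimer configuration $\Pi$ of $N$ is a set of edges that uses every interior vertex exactly once (boundary vertices may or may not be used). Its weight $\mathrm{wt}(\Pi)$ is the product of the weights of its edges, and $I(\Pi)\subseteq[n]=\{1,\dots,n\}$ is the set of black boundary vertices used by $\Pi$ together with the white boundary vertices not used by $\Pi$. Let $$k=\#\{\text{white boundary vertices}\}+\#\{\text{white interior vertices}\}-\#\{\text{black interior vertices}\},$$ suppose $k\ge 0$, and for each $k$-element subset $I\subseteq[n]$ define the boundary measurement $$\Delta_I(N)=\sum_{\Pi\,:\,I(\Pi)=I}\mathrm{wt}(\Pi).$$ Extend $I\mapsto\Delta_I(N)$ to an antisymmetric function of index sequences of length $k$ (zero if an index is repeated).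 Then the boundary measurements satisfy the Plücker relations: if $k\ge1$, then for all $i_1,\dots,i_{k-1}\in[n]$ and $j_1,\dots,j_{k+1}\in[n]$, $$\sum_{r=1}^{k+1}(-1)^r\,\Delta_{i_1,\dots,i_{k-1},j_r}(N)\,\Delta_{j_1,\dots,\widehat{j_r},\dots,j_{k+1}}(N)=0 .$$ Moreover, the vector $(\Delta_I(N))_{I\in\binom{[n]}{k}}$ is a point of the totally nonnegative part of the affine cone over the Grassmannian $\mathrm{Gr}(k,n)$ of $k$-planes in $\mathbb R^n$: all its coordinates are nonnegative, and it is either zero or a scalar multiple of the vector of maximal minors of a real $k\times n$ matrix with linearly independent rows. -/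

import Mathlib

/-- A finite bipartite network with interior vertices `V`, boundary vertices `1, …, n`
(here `Fin n`) and edges `E`, with a real weight on each edge.  Multiple edges are allowed.
Every vertex is black or white, and each edge joins a black vertex to a white one.
Boundary vertices have degree one, and no edge joins two boundary vertices. -/
structure BipartiteNetwork (n : ℕ) (V E : Type*) where
  /-- `true` for black vertices, `false` for white vertices -/
  isBlack : V ⊕ Fin n → Bool
  /-- the black endpoint of an edge -/
  blackEnd : E → V ⊕ Fin n
  /-- the white endpoint of an edge -/
  whiteEnd : E → V ⊕ Fin n
  isBlack_blackEnd : ∀ e, isBlack (blackEnd e) = true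
  isBlack_whiteEnd : ∀ e, isBlack (whiteEnd e) = false
  boundary_degree : ∀ i : Fin n, ∃! e : E, blackEnd e = Sum.inr i ∨ whiteEnd e = Sum.inr i
  not_boundary_boundary : ∀ (e : E) (i j : Fin n),
    ¬ (blackEnd e = Sum.inr i ∧ whiteEnd e = Sum.inr j)
  /-- the edge weights -/
  weight : E → ℝ

namespace BipartiteNetwork

variable {n : ℕ} {V E : Type*}

/-- The vertex `x` is an endpoint of the edge `e`. -/
def Incident (N : BipartiteNetwork n V E) (e : E) (x : V ⊕ Fin n) : Prop :=
  N.blackEnd e = x ∨ N.whiteEnd e = x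

/-- An embedding of the network into the closed unit disk of the plane `ℂ`: interior vertices are
distinct points of the open disk, boundary vertices are distinct points of the unit circle which
occur clockwise in the order `1, …, n`, and edges are simple arcs in the closed disk which meet
vertices and one another only at their endpoints. -/
structure DiskEmbedding (N : BipartiteNetwork n V E) where
  /-- the position of a vertex -/
  pos : V ⊕ Fin n → ℂ
  pos_injective : Function.Injective pos
  norm_pos_interior : ∀ v : V, ‖pos (Sum.inl v)‖ < 1
  /-- the polar angle of a boundary vertex; it decreases as one moves clockwise -/
  angle : Fin n → ℝ
  angle_strictAnti : StrictAnti angle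
  /-- the boundary vertices lie within a single turn -/
  angle_sub_lt : ∀ i j, angle i - angle j < 2 * Real.pi
  pos_boundary : ∀ i : Fin n, pos (Sum.inr i) = Complex.exp ((angle i : ℂ) * Complex.I)
  /-- the arc that represents an edge, from its black endpoint to its white endpoint -/
  arc : ∀ e : E, Path (pos (N.blackEnd e)) (pos (N.whiteEnd e))
  arc_injective : ∀ e, Function.Injective (arc e)
  norm_arc_le : ∀ e t, ‖arc e t‖ ≤ 1
  arc_eq_pos : ∀ e t x, arc e t = pos x → t = 0 ∨ t = 1
  arc_eq_arc : ∀ e e' s t, e ≠ e' → arc e s = arc e' t → (s = 0 ∨ s = 1) ∧ (t = 0 ∨ t = 1)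

/-- Dimer configurations (almost perfect matchings): sets of edges that use every interior vertex
exactly once.  Boundary vertices may or may not be used (at most once, as they have degree one). -/
def IsDimer (N : BipartiteNetwork n V E) (P : Finset E) : Prop :=
  ∀ v : V, ∃! e : E, e ∈ P ∧ N.Incident e (Sum.inl v)

/-- The boundary vertex `i` is used by the set of edges `P`. -/
def Used (N : BipartiteNetwork n V E) (P : Finset E) (i : Fin n) : Prop :=
  ∃ e ∈ P, N.Incident e (Sum.inr i)

open Classical in
/-- The boundary subset `I(P)`: the black boundary vertices that are used by `P`, together with the
white boundary vertices that are not used by `P`. -/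
noncomputable def boundarySubset (N : BipartiteNetwork n V E) (P : Finset E) : Finset (Fin n) :=
  {i | (N.isBlack (Sum.inr i) = true ∧ N.Used P i) ∨
    (N.isBlack (Sum.inr i) = false ∧ ¬ N.Used P i)}

/-- The integer `d' + d`, where `d'` is the number of white boundary vertices and `d` is the number
of interior white vertices minus the number of interior black vertices. -/
def rankInt [Fintype V] (N : BipartiteNetwork n V E) : ℤ :=
  (Finset.card {i : Fin n | N.isBlack (Sum.inr i) = false} : ℤ)
    + ((Finset.card {v : V | N.isBlack (Sum.inl v) = false} : ℤ)
      - (Finset.card {v : V | N.isBlack (Sum.inl v) = true} : ℤ))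

open Classical in
/-- The boundary measurement `Δ_I(N)`: the sum of the weights of the dimer configurations with
boundary subset `I`, the weight of a configuration being the product of its edge weights. -/
noncomputable def boundaryMeasurement [Fintype E] (N : BipartiteNetwork n V E)
    (I : Finset (Fin n)) : ℝ :=
  ∑ P : Finset E with N.IsDimer P ∧ N.boundarySubset P = I, ∏ e ∈ P, N.weight e

end BipartiteNetwork

/-- The `k`-element subsets of `{1, …, n}`. -/
abbrev KSubset (n k : ℕ) : Type := {I : Finset (Fin n) // I.card = k}

/-- The vector of boundary measurements `(Δ_I(N))` indexed by the `k`-element subsets `I`. -/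
noncomputable def BipartiteNetwork.measurementVector {n : ℕ} {V E : Type*} [Fintype E]
    (N : BipartiteNetwork n V E) (k : ℕ) : KSubset n k → ℝ :=
  fun I => N.boundaryMeasurement I.1

/-- The number of inversions of a sequence of indices. -/
def inversionCount {n l : ℕ} (f : Fin l → Fin n) : ℕ :=
  Finset.card {ab : Fin l × Fin l | ab.1 < ab.2 ∧ f ab.2 < f ab.1}

/-- The antisymmetric extension of `p` from `k`-element subsets to index sequences of length
`l = k`: the value is zero if an index is repeated, and otherwise it is the value of `p` at the set
of indices, with the sign of the permutation that sorts the sequence. -/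
def antisymExt {n k l : ℕ} (p : KSubset n k → ℝ) (f : Fin l → Fin n) : ℝ :=
  if h : (Finset.univ.image f).card = k then
    (-1) ^ inversionCount f * p ⟨Finset.univ.image f, h⟩
  else 0

/-- The Plücker relations
`∑ r, (-1) ^ r * Δ (i₁, …, i_{k-1}, j_r) * Δ (j₁, …, j_{r-1}, j_{r+1}, …, j_{k+1}) = 0`
for all index sequences `i₁, …, i_{k-1}` and `j₁, …, j_{k+1}` (where `k = m + 1`; there are no
relations if `k = 0`). -/
def PluckerRelations {n k : ℕ} (p : KSubset n k → ℝ) : Prop :=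
  ∀ m : ℕ, k = m + 1 → ∀ (i : Fin m → Fin n) (j : Fin (m + 2) → Fin n),
    ∑ r : Fin (m + 2), (-1 : ℝ) ^ (r : ℕ)
      * antisymExt p (Fin.snoc i (j r) : Fin (m + 1) → Fin n)
      * antisymExt p (j ∘ r.succAbove) = 0

/-- The maximal minors of a `k × n` matrix: the Plücker coordinates of its row space if the rows
are linearly independent. -/
noncomputable def pluckerCoords {n k : ℕ} (A : Matrix (Fin k) (Fin n) ℝ) : KSubset n k → ℝ :=
  fun I => (A.submatrix id (I.1.orderEmbOfFin I.2)).det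

/-- The affine cone over the real Grassmannian of `k`-planes in `ℝⁿ`: the zero vector and all
scalar multiples of the Plücker coordinate vectors of `k`-planes. -/
def grassmannianCone (n k : ℕ) : Set (KSubset n k → ℝ) :=
  {p | p = 0 ∨ ∃ A : Matrix (Fin k) (Fin n) ℝ, LinearIndependent ℝ A.row ∧
    ∃ c : ℝ, p = c • pluckerCoords A}

/-- The totally nonnegative part of the cone over the Grassmannian. -/
def tnnGrassmannianCone (n k : ℕ) : Set (KSubset n k → ℝ) :=
  {p | p ∈ grassmannianCone n k ∧ ∀ I, 0 ≤ p I}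

/-! Multiplied out, a Plücker relation is a signed sum over triples `(r, P, Q)`, where `P` and `Q`
are dimer configurations with boundary subsets I ∪ {x} and J \ {x}. Here x = j_r, and I and J are
the sets of the i's and the j's. Superpose `P` and `Q`. The components of `symmDiff P Q` pair up the
boundary vertices at which the two boundary subsets differ, each pair being the two ends of a path.
Exchanging `P` and `Q` along the path from x to its other end y gives a triple for y with the same
product of weights. This is a fixed-point-free involution on the triples.

Up to a common factor, the sign of a triple is given by the parity of #{z ∈ I : z > x} + #{z ∈ J : z
< x} (`plucker_sign`). Replacing x by y flips this parity as soon as evenly many points strictly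
between x and y lie in exactly one of I and J (`odd_card_add_card_of_lt`). Planarity supplies this
evenness: distinct components do not cross, so the points concerned are paired among themselves
(`IsDimer.even_card_between`). Hence all terms cancel. The topological input, that paths in the disk
with interlacing ends on the circle meet, is a winding number argument
(`exists_mem_inter_of_interlace`).

Nonnegativity is inherited from the weights. Membership in the cone is pure algebra: if p solves the
Plücker relations and p(I₀) ≠ 0, each argument of p can be expanded along I₀, so p is a multiple of
the maximal minors of a matrix of Cramer quotients (`PluckerRelations.mem_grassmannianCone`). -/

/-! ### Crossing paths in the disk. -/

/-- A continuous logarithm of a constant multiple of a function with values in the right half plane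
varies as the principal branch does. -/
theorem sub_log_eq_of_exp_eq_mul {L w : ℝ → ℂ} (hL : Continuous L) (hw : Continuous w)
    (hre : ∀ t, 0 < (w t).re) {p : ℂ} (hexp : ∀ t, Complex.exp (L t) = p * w t) (s t : ℝ) :
    L s - Complex.log (w s) = L t - Complex.log (w t) := by
  have hw0 : ∀ t, w t ≠ 0 := fun t h => by simpa [h] using hre t
  have hcont : Continuous fun t => L t - Complex.log (w t) :=
    hL.sub (hw.clog fun t => Or.inl (hre t))
  have hconst : ∀ t, Complex.exp (L t - Complex.log (w t)) = p := fun t => by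
    rw [Complex.exp_sub, hexp, Complex.exp_log (hw0 t), mul_div_cancel_right₀ _ (hw0 t)]
  -- Uniqueness of lifts along `exp`: this difference and the constant function equal to its value
  -- at `t` both lift the constant `p`.
  have := Complex.isCoveringMap_exp.eq_of_comp_eq (A := ℝ)
    (g₁ := fun t => L t - Complex.log (w t)) (g₂ := fun _ => L t - Complex.log (w t))
    hcont continuous_const (by ext u; simp [hconst]) t rfl
  exact congrFun this s

/-- Half-angle formulas give the polar form. For 0 < θ < 2π the factor 2 sin(θ/2) is positive and (θ
- π)/2 is the principal argument. -/
theorem one_sub_exp_mul_I (θ : ℝ) :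
    1 - Complex.exp (θ * Complex.I) = ((2 * Real.sin (θ / 2) : ℝ) : ℂ) *
      (Complex.cos ((θ - Real.pi) / 2 : ℝ) + Complex.sin ((θ - Real.pi) / 2 : ℝ) * Complex.I) := by
  have h1 : Real.cos ((θ - Real.pi) / 2) = Real.sin (θ / 2) := by
    rw [sub_div, Real.cos_sub_pi_div_two]
  have h2 : Real.sin ((θ - Real.pi) / 2) = - Real.cos (θ / 2) := by
    rw [sub_div, Real.sin_sub_pi_div_two]
  rw [← Complex.ofReal_cos, ← Complex.ofReal_sin, h1, h2]
  have hθ : θ = 2 * (θ / 2) := by ring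
  have h3 := Real.sin_sq_add_cos_sq (θ / 2)
  rw [Complex.exp_mul_I, ← Complex.ofReal_cos, ← Complex.ofReal_sin]
  have h4 : Real.cos θ = 1 - 2 * Real.sin (θ / 2) ^ 2 := by
    conv_lhs => rw [hθ, Real.cos_two_mul]
    linarith
  have h5 : Real.sin θ = 2 * Real.sin (θ / 2) * Real.cos (θ / 2) := by
    conv_lhs => rw [hθ, Real.sin_two_mul]
  apply Complex.ext
  · simp [h4, pow_two, -Complex.ofReal_sin, -Complex.ofReal_cos]
    ring
  · simp [h5, -Complex.ofReal_sin, -Complex.ofReal_cos]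

theorem arg_one_sub_exp_of_pos {θ : ℝ} (h0 : 0 < θ) (h1 : θ < 2 * Real.pi) :
    (1 - Complex.exp (θ * Complex.I)).arg = (θ - Real.pi) / 2 := by
  rw [one_sub_exp_mul_I, Complex.arg_mul_cos_add_sin_mul_I]
  · have : 0 < Real.sin (θ / 2) := Real.sin_pos_of_pos_of_lt_pi (by linarith) (by linarith)
    linarith
  · constructor <;> linarith

theorem arg_one_sub_exp_of_neg {θ : ℝ} (h0 : θ < 0) (h1 : -(2 * Real.pi) < θ) :
    (1 - Complex.exp (θ * Complex.I)).arg = (θ + Real.pi) / 2 := by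
  have h := arg_one_sub_exp_of_pos (θ := θ + 2 * Real.pi) (by linarith) (by linarith)
  have : Complex.exp ((θ + 2 * Real.pi : ℝ) * Complex.I) = Complex.exp (θ * Complex.I) := by
    rw [← Complex.exp_periodic (θ * Complex.I)]
    push_cast
    ring_nf
  rw [this] at h
  rw [h]
  ring

/-- A point of the closed unit disk other than the point `p` of the circle lies on the inner side
of the tangent at `p`. -/
theorem re_one_sub_div_pos {p z : ℂ} (hp : ‖p‖ = 1) (hz : ‖z‖ ≤ 1) (hne : z ≠ p) :
    0 < (1 - z / p).re := by
  have hp0 : p ≠ 0 := fun h => by simp [h] at hp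
  have hn : ‖z / p‖ ≤ 1 := by rw [norm_div, hp, div_one]; exact hz
  have hle : (z / p).re ≤ 1 := (Complex.re_le_norm _).trans hn
  rw [Complex.sub_re, Complex.one_re, sub_pos]
  refine lt_of_le_of_ne hle fun h1 => hne ?_
  have him : (z / p).im = 0 := by
    have := Complex.sq_norm_sub_sq_re (z / p)
    rw [h1] at this
    nlinarith [sq_nonneg (z / p).im, norm_nonneg (z / p)]
  have : z / p = 1 := Complex.ext (by simpa using h1) (by simpa using him)
  rwa [div_eq_one_iff_eq hp0] at this

/-- Two paths in the closed unit disk whose endpoints interlace on the unit circle meet. -/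
theorem exists_mem_inter_of_interlace {a b c d : ℝ} (hab : b < a) (hbc : c < b) (hcd : d < c)
    (had : a - d < 2 * Real.pi) {F G : Set ℂ} (hF : ∀ z ∈ F, ‖z‖ ≤ 1) (hG : ∀ z ∈ G, ‖z‖ ≤ 1)
    (h₁ : JoinedIn F (Complex.exp (a * Complex.I)) (Complex.exp (c * Complex.I)))
    (h₂ : JoinedIn G (Complex.exp (b * Complex.I)) (Complex.exp (d * Complex.I))) :
    ∃ z, z ∈ F ∧ z ∈ G := by
  by_contra hdisj
  push Not at hdisj
  obtain ⟨γ, hγ⟩ := h₁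
  obtain ⟨η, hη⟩ := h₂
  set g : ℝ → ℂ := fun t => γ.extend t with hg
  set h : ℝ → ℂ := fun t => η.extend t with hh
  have hgF : ∀ t, g t ∈ F := fun t => hγ _
  have hhG : ∀ t, h t ∈ G := fun t => hη _
  have hgc : Continuous g := γ.extend.continuous
  have hhc : Continuous h := η.extend.continuous
  have g0 : g 0 = Complex.exp (a * Complex.I) := γ.extend_zero
  have g1 : g 1 = Complex.exp (c * Complex.I) := γ.extend_one
  have h0 : h 0 = Complex.exp (b * Complex.I) := η.extend_zero
  have h1 : h 1 = Complex.exp (d * Complex.I) := η.extend_one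
  have hne : ∀ s t, g s ≠ h t := fun s t e => hdisj _ (hgF s) (e ▸ hhG t)
  -- If the paths are disjoint, g(s) - h(t) never vanishes on the simply connected plane, so it has
  -- a global continuous logarithm `L`.
  have hsc : IsSimplyConnected (Set.univ : Set (ℝ × ℝ)) := by
    have := (convex_univ (𝕜 := ℝ) (E := ℝ × ℝ)).contractibleSpace ⟨0, trivial⟩
    exact inferInstanceAs (SimplyConnectedSpace (Set.univ : Set (ℝ × ℝ)))
  obtain ⟨L, hLc, hL⟩ := Complex.exists_continuousOn_eqOn_exp_comp hsc isOpen_univ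
    (g := fun q : ℝ × ℝ => g q.1 - h q.2) (by fun_prop)
    (by rintro ⟨q, -, hq⟩; exact hne _ _ (sub_eq_zero.1 hq))
  rw [continuousOn_univ] at hLc
  replace hL : ∀ s t, Complex.exp (L (s, t)) = g s - h t := fun s t => hL (Set.mem_univ (s, t))
  have hnorm : ∀ x : ℝ, ‖Complex.exp (x * Complex.I)‖ = 1 := fun x => Complex.norm_exp_ofReal_mul_I x
  have he0 : ∀ x : ℝ, Complex.exp (x * Complex.I) ≠ 0 := fun x => Complex.exp_ne_zero _
  have hdiv : ∀ x y : ℝ, Complex.exp (x * Complex.I) / Complex.exp (y * Complex.I)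
      = Complex.exp ((x - y : ℝ) * Complex.I) := fun x y => by
    rw [← Complex.exp_sub]; push_cast; ring_nf
  -- the four sides of the square
  have side_g : ∀ (s x : ℝ), g s = Complex.exp (x * Complex.I) →
      (L (s, 1)).im - (1 - Complex.exp ((d - x : ℝ) * Complex.I)).arg =
      (L (s, 0)).im - (1 - Complex.exp ((b - x : ℝ) * Complex.I)).arg := fun s x hx => by
    have := sub_log_eq_of_exp_eq_mul (L := fun t => L (s, t))
      (w := fun t => 1 - h t / Complex.exp (x * Complex.I)) (p := Complex.exp (x * Complex.I))
      (by fun_prop) (by fun_prop)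
      (fun t => re_one_sub_div_pos (hnorm x) (hG _ (hhG t)) (hx ▸ (hne s t).symm))
      (fun t => by rw [hL, hx, mul_sub, mul_div_cancel₀ _ (he0 x), mul_one]) 1 0
    have := congrArg Complex.im this
    simpa [Complex.log_im, h0, h1, hdiv] using this
  have side_h : ∀ (t x : ℝ), h t = Complex.exp (x * Complex.I) →
      (L (1, t)).im - (1 - Complex.exp ((c - x : ℝ) * Complex.I)).arg =
      (L (0, t)).im - (1 - Complex.exp ((a - x : ℝ) * Complex.I)).arg := fun t x hx => by
    have := sub_log_eq_of_exp_eq_mul (L := fun s => L (s, t))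
      (w := fun s => 1 - g s / Complex.exp (x * Complex.I)) (p := -Complex.exp (x * Complex.I))
      (by fun_prop) (by fun_prop)
      (fun s => re_one_sub_div_pos (hnorm x) (hF _ (hgF s)) (hx ▸ (hne s t)))
      (fun s => by rw [hL, hx, neg_mul, mul_sub, mul_div_cancel₀ _ (he0 x)]; ring) 1 0
    have := congrArg Complex.im this
    simpa [Complex.log_im, g0, g1, hdiv] using this
  have e1 := side_g 0 a g0
  have e2 := side_g 1 c g1
  have e3 := side_h 0 b h0
  have e4 := side_h 1 d h1
  -- In `e1` and `e4` both angle differences have the same sign and the terms ±π/2 cancel. In `e2`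
  -- and `e3` the signs are opposite and each contributes π. The two routes from (0,0) to (1,1) thus
  -- give values of Im `L` that differ by 2π.
  rw [arg_one_sub_exp_of_neg (by linarith) (by linarith),
    arg_one_sub_exp_of_neg (by linarith) (by linarith)] at e1
  rw [arg_one_sub_exp_of_neg (by linarith) (by linarith),
    arg_one_sub_exp_of_pos (by linarith) (by linarith)] at e2 e3
  rw [arg_one_sub_exp_of_pos (by linarith) (by linarith),
    arg_one_sub_exp_of_pos (by linarith) (by linarith)] at e4
  linarith [Real.pi_pos]

/-! ### Signs of index sequences and antisymmetric extension. -/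

theorem inversionCount_eq_sum {n l : ℕ} (f : Fin l → Fin n) :
    inversionCount f = ∑ a, ∑ b, if a < b ∧ f b < f a then 1 else 0 := by
  rw [inversionCount, Finset.card_filter, ← Finset.univ_product_univ, Finset.sum_product]

theorem inversionCount_snoc {n l : ℕ} (f : Fin l → Fin n) (x : Fin n) :
    inversionCount (Fin.snoc f x : Fin (l + 1) → Fin n) =
      inversionCount f + Finset.card {t | x < f t} := by
  simp [inversionCount_eq_sum, Fin.sum_univ_castSucc, Finset.sum_add_distrib, Finset.card_filter,
    Fin.castSucc_lt_last, Fin.not_lt.2 (Fin.le_last _), -Finset.sum_boole]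

/-- Deleting position `r` loses the inversions through `r`. Adding `r`, the number of earlier
positions, counts every earlier larger entry twice (this is `c`) and every smaller or earlier equal
entry once. -/
theorem inversionCount_succAbove {n l : ℕ} (f : Fin (l + 1) → Fin n) (r : Fin (l + 1)) :
    ∃ c, r + inversionCount f = inversionCount (f ∘ r.succAbove) + Finset.card {t | f t < f r} +
      Finset.card {t | t < r ∧ f t = f r} + 2 * c := by
  have hr : (r : ℕ) = ∑ b : Fin (l + 1), if b < r then 1 else 0 := by
    rw [← Finset.card_filter, Finset.filter_gt_eq_Iio, Fin.card_Iio]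
  refine ⟨∑ b : Fin l, if r.succAbove b < r ∧ f r < f (r.succAbove b) then 1 else 0, ?_⟩
  rw [hr]
  simp only [inversionCount_eq_sum, Finset.card_filter, Fin.sum_univ_succAbove _ r, lt_self_iff_false,
    false_and, and_false, if_false, zero_add, Finset.sum_add_distrib, Function.comp,
    Fin.succAbove_lt_succAbove_iff]
  have key : ∀ b : Fin l, ((if r.succAbove b < r then 1 else 0) +
      (if r < r.succAbove b ∧ f (r.succAbove b) < f r then 1 else 0) +
      (if r.succAbove b < r ∧ f r < f (r.succAbove b) then 1 else 0) : ℕ) =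
      (if f (r.succAbove b) < f r then 1 else 0) +
      (if r.succAbove b < r ∧ f (r.succAbove b) = f r then 1 else 0) +
      2 * (if r.succAbove b < r ∧ f r < f (r.succAbove b) then 1 else 0) := fun b => by
    have hne := Fin.succAbove_ne r b
    grind
  have := Finset.sum_congr (rfl : (Finset.univ : Finset (Fin l)) = Finset.univ) fun b _ => key b
  simp only [Finset.sum_add_distrib, ← Finset.mul_sum] at this
  omega

theorem neg_one_pow_mul_inversionCount_succAbove {n l : ℕ} (f : Fin (l + 1) → Fin n)
    (r : Fin (l + 1)) :
    (-1 : ℝ) ^ (r : ℕ) * (-1) ^ inversionCount (f ∘ r.succAbove) =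
      (-1) ^ (inversionCount f + Finset.card {t | f t < f r} +
        Finset.card {t | t < r ∧ f t = f r}) := by
  obtain ⟨c, hc⟩ := inversionCount_succAbove f r
  rw [← pow_add]
  apply neg_one_pow_congr
  grind

theorem inversionCount_of_strictMono {n l : ℕ} {f : Fin l → Fin n} (hf : StrictMono f) :
    inversionCount f = 0 := by
  rw [inversionCount, Finset.card_eq_zero, Finset.filter_eq_empty_iff]
  rintro ⟨a, b⟩ - ⟨h1, h2⟩
  exact lt_asymm h2 (hf h1)

/-- A product over pairs of an antisymmetric kernel changes by the sign of the permutation when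
positions are permuted. The value 0 keeps the kernel antisymmetric on equal entries. -/
theorem neg_one_pow_inversionCount {n l : ℕ} {f : Fin l → Fin n} (hf : Function.Injective f) :
    (-1 : ℝ) ^ inversionCount f = ∏ b, ∏ a ∈ Finset.Iio b,
      (if f a < f b then 1 else if f b < f a then -1 else 0) := by
  have h : ∀ b, ∏ a ∈ Finset.Iio b, (if f a < f b then 1 else if f b < f a then -1 else 0 : ℝ) =
      ∏ a, if a < b ∧ f b < f a then -1 else 1 := fun b => by
    rw [← Finset.filter_gt_eq_Iio, Finset.prod_filter]
    refine Finset.prod_congr rfl fun a _ => ?_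
    have := @hf a b
    grind
  simp_rw [h]
  rw [Finset.prod_comm, inversionCount, ← Finset.prod_const, Finset.prod_filter,
    ← Finset.univ_product_univ, Finset.prod_product]

theorem neg_one_pow_inversionCount_comp_perm {n l : ℕ} {f : Fin l → Fin n}
    (hf : Function.Injective f) (σ : Equiv.Perm (Fin l)) :
    (-1 : ℝ) ^ inversionCount (f ∘ σ) = Equiv.Perm.sign σ * (-1) ^ inversionCount f := by
  rw [neg_one_pow_inversionCount hf, neg_one_pow_inversionCount (hf.comp σ.injective)]
  exact σ.prod_Iio_comp_eq_sign_mul_prod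
    (f := fun a b => if f a < f b then (1 : ℝ) else if f b < f a then -1 else 0) (by grind)

section antisymExt

variable {n k : ℕ} (p : KSubset n k → ℝ)

theorem card_image_univ_eq_iff_injective {k : ℕ} {α : Type*} [DecidableEq α] {f : Fin k → α} :
    (Finset.univ.image f).card = k ↔ Function.Injective f := by
  rw [← Set.injOn_univ, ← Finset.coe_univ, ← Finset.card_image_iff, Finset.card_univ,
    Fintype.card_fin]

theorem antisymExt_of_injective {f : Fin k → Fin n} (hf : Function.Injective f) :
    antisymExt p f = (-1) ^ inversionCount f *
      p ⟨Finset.univ.image f, card_image_univ_eq_iff_injective.2 hf⟩ :=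
  dif_pos _

theorem antisymExt_of_not_injective {f : Fin k → Fin n} (hf : ¬ Function.Injective f) :
    antisymExt p f = 0 :=
  dif_neg (mt card_image_univ_eq_iff_injective.1 hf)

theorem antisymExt_comp_perm (f : Fin k → Fin n) (σ : Equiv.Perm (Fin k)) :
    antisymExt p (f ∘ σ) = Equiv.Perm.sign σ * antisymExt p f := by
  by_cases hf : Function.Injective f
  · rw [antisymExt_of_injective p hf, antisymExt_of_injective p (hf.comp σ.injective),
      neg_one_pow_inversionCount_comp_perm hf, mul_assoc]
    congr 4
    ext x
    simp only [Finset.mem_image, Finset.mem_univ, true_and, Function.comp]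
    exact (σ.surjective.exists (p := fun a => f a = x)).symm
  · rw [antisymExt_of_not_injective p hf, antisymExt_of_not_injective, mul_zero]
    rwa [σ.injective_comp]

theorem antisymExt_orderEmbOfFin (I : KSubset n k) :
    antisymExt p (I.1.orderEmbOfFin I.2) = p I := by
  rw [antisymExt_of_injective p (I.1.orderEmbOfFin I.2).injective,
    inversionCount_of_strictMono (I.1.orderEmbOfFin I.2).strictMono, pow_zero, one_mul]
  congr 1
  exact Subtype.ext (Finset.image_orderEmbOfFin_univ I.1 I.2)

end antisymExt

/-! ### From the Plücker relations to maximal minors. -/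

/-- A function of sequences that can be expanded in each argument along given elements is
determined by its values on sequences of these elements. -/
theorem sum_prod_of_expand {ι X : Type*} [Fintype ι] {k : ℕ} (A : ι → X → ℝ) (y : ι → X)
    (G : (Fin k → X) → ℝ)
    (hG : ∀ f b, G f = ∑ a, A a (f b) * G (Function.update f b (y a))) (f : Fin k → X) :
    G f = ∑ c : Fin k → ι, (∏ b, A (c b) (f b)) * G (y ∘ c) := by
  induction k with
  | zero => simp [Subsingleton.elim (y ∘ _) f]
  | succ k ih =>
    rw [hG f 0]
    have h1 : ∀ a, G (Function.update f 0 (y a)) =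
        ∑ c : Fin k → ι, (∏ b, A (c b) (f b.succ)) * G (Fin.cons (y a) (y ∘ c)) := fun a => by
      have := ih (fun h => G (Fin.cons (y a) h)) (fun h b => by
        rw [hG _ b.succ]
        simp [Fin.cons_update]) (Fin.tail f)
      have hf : (Function.update f 0 (y a)) = Fin.cons (y a) (Fin.tail f) := by
        rw [← Fin.cons_self_tail f, Fin.update_cons_zero, Fin.tail_cons]
      rw [hf]
      exact this
    simp_rw [h1, Finset.mul_sum]
    rw [← (Fin.consEquiv fun _ => ι).sum_comp, Fintype.sum_prod_type]
    refine Finset.sum_congr rfl fun a _ => Finset.sum_congr rfl fun c _ => ?_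
    rw [Fin.prod_univ_succ]
    simp only [Fin.consEquiv_apply, Fin.cons_zero, Fin.cons_succ, mul_assoc]
    congr 3
    ext b
    cases b using Fin.cases <;> rfl

/-- This is the Plücker relation for the sequence `x`, `f₀`. The term `r = 0` gives the left side;
in the others `x` is moved into the vacated position `a` by a cycle of sign (-1)^a, which cancels
the alternating sign. -/
theorem PluckerRelations.expand_last {n m : ℕ} {p : KSubset n (m + 1) → ℝ}
    (hp : PluckerRelations p) (f₀ : Fin (m + 1) → Fin n) (i : Fin m → Fin n) (x : Fin n) :
    antisymExt p (Fin.snoc i x : Fin (m + 1) → Fin n) * antisymExt p f₀ =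
      ∑ a, antisymExt p (Function.update f₀ a x) *
        antisymExt p (Fin.snoc i (f₀ a) : Fin (m + 1) → Fin n) := by
  have h := hp m rfl i (Fin.cons x f₀)
  rw [Fin.sum_univ_succ] at h
  have h0 : (Fin.cons x f₀ : Fin (m + 2) → Fin n) ∘ Fin.succAbove 0 = f₀ := by
    ext b; simp
  have h1 : ∀ a : Fin (m + 1), (Fin.cons x f₀ : Fin (m + 2) → Fin n) ∘ a.succ.succAbove =
      Function.update f₀ a x ∘ a.cycleRange.symm := fun a => by
    rw [← Fin.cons_removeNth_eq_comp_cycleRange_symm]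
    ext b
    cases b using Fin.cases <;> simp [Fin.removeNth]
  rw [h0] at h
  simp_rw [h1, antisymExt_comp_perm] at h
  simp only [Fin.cons_zero, Fin.cons_succ, Fin.val_zero, pow_zero, one_mul, Fin.val_succ,
    Equiv.Perm.sign_symm, Fin.sign_cycleRange] at h
  rw [eq_neg_of_add_eq_zero_left h, ← Finset.sum_neg_distrib]
  refine Finset.sum_congr rfl fun a _ => ?_
  have h2 : ((-1 : ℝ) ^ (a : ℕ)) * (-1) ^ (a : ℕ) = 1 := by
    rw [← mul_pow]; simp
  push_cast
  linear_combination (antisymExt p (Function.update f₀ a x) *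
        antisymExt p (Fin.snoc i (f₀ a) : Fin (m + 1) → Fin n)) * h2

/-- A transposition of `b` with the last position reduces this to `expand_last`. -/
theorem PluckerRelations.expand {n k : ℕ} {p : KSubset n k → ℝ}
    (hp : PluckerRelations p) (f₀ f : Fin k → Fin n) (b : Fin k) :
    antisymExt p f * antisymExt p f₀ =
      ∑ a, antisymExt p (Function.update f₀ a (f b)) *
        antisymExt p (Function.update f b (f₀ a)) := by
  obtain _ | m := k
  · exact b.elim0
  let σ : Equiv.Perm (Fin (m + 1)) := Equiv.swap b (Fin.last m)
  have hs : ∀ y, (Fin.snoc (Fin.init (f ∘ σ)) y : Fin (m + 1) → Fin n) =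
      Function.update f b y ∘ σ := fun y => by
    rw [← Fin.update_snoc_last (x := (f ∘ σ) (Fin.last m)), Fin.snoc_init_self]
    ext t
    by_cases h : t = Fin.last m
    · subst h; simp [σ]
    · rw [Function.update_of_ne h, Function.comp, Function.comp, Function.update_of_ne]
      intro h'
      exact h (by rw [← Equiv.symm_apply_apply σ t, h']; simp [σ])
  have h := hp.expand_last f₀ (Fin.init (f ∘ σ)) (f b)
  simp_rw [hs, antisymExt_comp_perm, Function.update_eq_self] at h
  have hσ : ((Equiv.Perm.sign σ : ℤ) : ℝ) ≠ 0 := by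
    exact_mod_cast (Equiv.Perm.sign σ).ne_zero
  apply mul_left_cancel₀ hσ
  rw [← mul_assoc, h, Finset.mul_sum]
  exact Finset.sum_congr rfl fun a _ => by ring

/-- Solutions of the Plücker relations lie in the affine cone over the Grassmannian. -/
theorem PluckerRelations.mem_grassmannianCone {n k : ℕ} {p : KSubset n k → ℝ}
    (hp : PluckerRelations p) : p ∈ grassmannianCone n k := by
  by_cases h0 : p = 0
  · exact Or.inl h0
  obtain ⟨I₀, hI₀⟩ := Function.ne_iff.1 h0
  set f₀ : Fin k → Fin n := ⇑(I₀.1.orderEmbOfFin I₀.2)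
  have hq : antisymExt p f₀ = p I₀ := antisymExt_orderEmbOfFin p I₀
  have hq0 : antisymExt p f₀ ≠ 0 := by rw [hq]; exact hI₀
  -- Cramer's rule: these are the coordinates of column `x` in the basis of columns `f₀`, so the
  -- columns `f₀` of `A` form the identity matrix.
  let A : Matrix (Fin k) (Fin n) ℝ :=
    fun a x => antisymExt p (Function.update f₀ a x) / antisymExt p f₀
  have hdet : ∀ f : Fin k → Fin n, antisymExt p f = antisymExt p f₀ * (A.submatrix id f).det :=
    fun f => by
    rw [sum_prod_of_expand A f₀ (antisymExt p) (fun g b => by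
      apply mul_right_cancel₀ hq0
      rw [hp.expand f₀ g b, Finset.sum_mul]
      refine Finset.sum_congr rfl fun a _ => ?_
      simp only [A]
      field_simp) f, Matrix.det_apply', Finset.mul_sum]
    -- Only injective `c`, that is permutations, contribute; this leaves the Leibniz formula.
    rw [← Finset.sum_subset (Finset.subset_univ
      (Finset.univ.image fun σ : Equiv.Perm (Fin k) => (σ : Fin k → Fin k))),
      Finset.sum_image (fun _ _ _ _ h => DFunLike.coe_injective h)]
    · refine Finset.sum_congr rfl fun σ _ => ?_
      rw [antisymExt_comp_perm]
      simp only [Matrix.submatrix_apply, id]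
      ring
    · intro c _ hc
      rw [antisymExt_of_not_injective, mul_zero]
      intro hinj
      apply hc
      have hci : Function.Injective c := hinj.of_comp
      exact Finset.mem_image.2 ⟨Equiv.ofBijective c hci.bijective_of_finite, Finset.mem_univ _, rfl⟩
  refine Or.inr ⟨A, ?_, antisymExt p f₀, ?_⟩
  · have h1 : A.submatrix id f₀ = 1 := by
      ext a b
      rw [Matrix.submatrix_apply]
      by_cases hab : a = b
      · subst hab
        simp [A, div_self hq0]
      · have : ¬ Function.Injective (Function.update f₀ a (f₀ b)) := fun h =>
          hab (h (by rw [Function.update_self, Function.update_of_ne (Ne.symm hab)]))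
        simp [A, antisymExt_of_not_injective p this, hab]
    have h2 : LinearIndependent ℝ (A.submatrix id f₀).row := by
      rw [h1, Matrix.linearIndependent_rows_iff_isUnit]
      exact isUnit_one
    exact h2.of_comp (LinearMap.funLeft ℝ ℝ f₀)
  · ext I
    rw [← antisymExt_orderEmbOfFin p I, hdet]
    rfl

/-! ### Cycles of a product of two involutions. -/

namespace Equiv.Perm

variable {X : Type*} {α β : Equiv.Perm X}

/-- Dihedral relation: conjugation by `α` inverts `β * α`. -/
theorem inv_zpow_of_conj (hα : ∀ v, α (α v) = v) (hβ : ∀ v, β (β v) = v) (k : ℤ) (v : X) :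
    α (((β * α) ^ k) v) = ((β * α) ^ (-k)) (α v) := by
  have h1 : α⁻¹ = α := by ext v; rw [Equiv.Perm.inv_eq_iff_eq, hα]
  have h2 : β⁻¹ = β := by ext v; rw [Equiv.Perm.inv_eq_iff_eq, hβ]
  have h3 : α * (β * α) ^ k * α⁻¹ = (β * α) ^ (-k) := by
    rw [← conj_zpow, zpow_neg, ← inv_zpow, mul_inv_rev, h1, h2]
    congr 1
    ext v
    simp [hα]
  have := congrArg (fun σ : Equiv.Perm X => σ (α v)) h3
  simpa [h1, hα] using this

/-- For involutions `α` and `β`, the cycle of `β * α` at a fixed point of `α` is stable under `α`. -/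
theorem sameCycle_involution_left (hα : ∀ v, α (α v) = v) (hβ : ∀ v, β (β v) = v) {a v : X}
    (ha : α a = a ∨ β a = a) (hv : (β * α).SameCycle a v) : (β * α).SameCycle a (α v) := by
  have h : (β * α).SameCycle a (α a) := by
    rcases ha with ha | ha
    · rw [ha]
    · refine ⟨-1, ?_⟩
      rw [zpow_neg_one, Equiv.Perm.inv_eq_iff_eq, mul_apply, hα, ha]
  obtain ⟨k, rfl⟩ := hv
  rw [inv_zpow_of_conj hα hβ]
  exact h.trans ⟨-k, rfl⟩

theorem sameCycle_involution_right (hα : ∀ v, α (α v) = v) (hβ : ∀ v, β (β v) = v) {a v : X}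
    (ha : α a = a ∨ β a = a) (hv : (β * α).SameCycle a v) : (β * α).SameCycle a (β v) := by
  have := sameCycle_involution_left hα hβ ha hv
  have h2 : (β * α) (α v) = β v := by rw [mul_apply, hα]
  rw [← h2]
  exact Equiv.Perm.sameCycle_apply_right.2 this

/-- On the points g^s a the involutions act by s ↦ -s and s ↦ 1 - s modulo the period L, with L = 0
for an infinite cycle. Fixed points satisfy 2s ≡ 0 or 2s ≡ 1. Apart from s ≡ 0, each congruence has
at most one solution modulo L, and they exclude each other: 2s ≡ 0 and 2t ≡ 1 give s ≡ 2st ≡ 0. -/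
theorem eq_of_sameCycle_of_fixed_left (hα : ∀ v, α (α v) = v) (hβ : ∀ v, β (β v) = v) {a i j : X}
    (ha : α a = a) (hi : α i = i ∨ β i = i) (hj : α j = j ∨ β j = j)
    (hai : (β * α).SameCycle a i) (haj : (β * α).SameCycle a j) (hia : i ≠ a) (hja : j ≠ a) :
    i = j := by
  set g := β * α with hg
  obtain ⟨L, hL⟩ : ∃ L : ℤ, L = Nat.cast (Function.minimalPeriod (fun v => g • v) a) := ⟨_, rfl⟩
  have hdvd : ∀ m : ℤ, (g ^ m) a = a ↔ L ∣ m := fun m =>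
    hL ▸ MulAction.zpow_smul_eq_iff_minimalPeriod_dvd (a := g) (b := a)
  have hcongr : ∀ s t : ℤ, (g ^ s) a = (g ^ t) a ↔ L ∣ s - t := fun s t => by
    rw [← hdvd, sub_eq_neg_add, zpow_add, mul_apply, zpow_neg, Equiv.Perm.inv_eq_iff_eq]
  have hαs : ∀ s : ℤ, α ((g ^ s) a) = (g ^ (-s)) a := fun s => by
    rw [inv_zpow_of_conj hα hβ, ha]
  have hβs : ∀ s : ℤ, β ((g ^ s) a) = (g ^ (1 - s)) a := fun s => by
    rw [sub_eq_add_neg, zpow_add, mul_apply, ← hαs, zpow_one, hg, mul_apply, hα]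
  obtain ⟨s, rfl⟩ := hai
  obtain ⟨t, rfl⟩ := haj
  rw [Ne, hdvd] at hia hja
  rw [hαs, hβs, hcongr, hcongr] at hi hj
  rw [hcongr]
  rcases hi with ⟨u, hu⟩ | ⟨u, hu⟩ <;> rcases hj with ⟨v, hv⟩ | ⟨v, hv⟩
  · obtain ⟨u', rfl | rfl⟩ := Int.even_or_odd' u
    · exact absurd ⟨-u', by linarith⟩ hia
    obtain ⟨v', rfl | rfl⟩ := Int.even_or_odd' v
    · exact absurd ⟨-v', by linarith⟩ hja
    exact ⟨v' - u', by linarith⟩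
  · exact absurd ⟨s * v - t * u, by linear_combination s * hv - t * hu⟩ hia
  · exact absurd ⟨t * u - s * v, by linear_combination t * hu - s * hv⟩ hja
  · exact ⟨(s - t) * u + s * (v - u), by linear_combination (s - t) * hu + s * (hv - hu)⟩

theorem eq_of_sameCycle_of_fixed (hα : ∀ v, α (α v) = v) (hβ : ∀ v, β (β v) = v) {a i j : X}
    (ha : α a = a ∨ β a = a) (hi : α i = i ∨ β i = i) (hj : α j = j ∨ β j = j)
    (hai : (β * α).SameCycle a i) (haj : (β * α).SameCycle a j) (hia : i ≠ a) (hja : j ≠ a) :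
    i = j := by
  rcases ha with ha | ha
  · exact eq_of_sameCycle_of_fixed_left hα hβ ha hi hj hai haj hia hja
  · have h1 : α⁻¹ = α := by ext v; rw [Equiv.Perm.inv_eq_iff_eq, hα]
    have h2 : β⁻¹ = β := by ext v; rw [Equiv.Perm.inv_eq_iff_eq, hβ]
    -- Exchanging the involutions inverts the product, which has the same cycles.
    have h : (β * α)⁻¹ = α * β := by rw [mul_inv_rev, h1, h2]
    rw [← Equiv.Perm.sameCycle_inv, h] at hai haj
    exact eq_of_sameCycle_of_fixed_left hβ hα ha hi.symm hj.symm hai haj hia hja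

end Equiv.Perm

/-! ### Components of edge sets in the embedded network. -/

namespace BipartiteNetwork

variable {n : ℕ} {V E : Type*} (N : BipartiteNetwork n V E)

/-- Two vertices are connected by edges in `D`. -/
def Conn (D : Finset E) : V ⊕ Fin n → V ⊕ Fin n → Prop :=
  Relation.EqvGen fun u v => ∃ e ∈ D, N.blackEnd e = u ∧ N.whiteEnd e = v

variable {N}

theorem Conn.symm {D : Finset E} {u v : V ⊕ Fin n} (h : N.Conn D u v) : N.Conn D v u :=
  Relation.EqvGen.symm _ _ h

theorem Conn.trans {D : Finset E} {u v w : V ⊕ Fin n} (h : N.Conn D u v) (h' : N.Conn D v w) :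
    N.Conn D u w :=
  Relation.EqvGen.trans _ _ _ h h'

theorem Conn.refl (D : Finset E) (u : V ⊕ Fin n) : N.Conn D u u :=
  Relation.EqvGen.refl _

theorem conn_ends {D : Finset E} {e : E} (he : e ∈ D) :
    N.Conn D (N.blackEnd e) (N.whiteEnd e) :=
  Relation.EqvGen.rel _ _ ⟨e, he, rfl, rfl⟩

/-- The part of the plane covered by the component of a vertex. -/
def DiskEmbedding.region (φ : N.DiskEmbedding) (D : Finset E) (c : V ⊕ Fin n) : Set ℂ :=
  {z | ∃ v, N.Conn D c v ∧ (z = φ.pos v ∨ ∃ e ∈ D, N.blackEnd e = v ∧ ∃ t, z = φ.arc e t)}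

theorem DiskEmbedding.norm_pos_le (φ : N.DiskEmbedding) (v : V ⊕ Fin n) : ‖φ.pos v‖ ≤ 1 := by
  rcases v with v | i
  · exact (φ.norm_pos_interior v).le
  · rw [φ.pos_boundary, Complex.norm_exp_ofReal_mul_I]

theorem DiskEmbedding.norm_le_of_mem_region (φ : N.DiskEmbedding) {D : Finset E} {c : V ⊕ Fin n}
    {z : ℂ} (hz : z ∈ φ.region D c) : ‖z‖ ≤ 1 := by
  obtain ⟨v, -, rfl | ⟨e, -, -, t, rfl⟩⟩ := hz
  · exact φ.norm_pos_le v
  · exact φ.norm_arc_le e t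

theorem DiskEmbedding.joinedIn_region (φ : N.DiskEmbedding) {D : Finset E} {c u v : V ⊕ Fin n}
    (huv : N.Conn D u v) (hu : N.Conn D c u) :
    JoinedIn (φ.region D c) (φ.pos u) (φ.pos v) := by
  induction huv with
  | rel u v h =>
    obtain ⟨e, he, rfl, rfl⟩ := h
    exact ⟨φ.arc e, fun t => ⟨_, hu, Or.inr ⟨e, he, rfl, t, rfl⟩⟩⟩
  | refl u => exact JoinedIn.refl ⟨u, hu, Or.inl rfl⟩
  | symm u v h ih => exact (ih (hu.trans (Conn.symm h))).symm
  | trans u v w h _ ih ih' => exact (ih hu).trans (ih' (hu.trans h))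

theorem DiskEmbedding.conn_of_arc_eq_pos (φ : N.DiskEmbedding) {D : Finset E} {e : E} (he : e ∈ D)
    {t : unitInterval} {v : V ⊕ Fin n} (h : φ.arc e t = φ.pos v) : N.Conn D (N.blackEnd e) v := by
  obtain rfl | rfl := φ.arc_eq_pos e t v h
  · rw [Path.source] at h
    rw [φ.pos_injective h]
    exact Conn.refl _ _
  · rw [Path.target] at h
    rw [← φ.pos_injective h]
    exact conn_ends he

/-- Arcs meet only at common endpoints, and these are vertices, so regions of different components
are disjoint. -/
theorem DiskEmbedding.conn_of_mem_region (φ : N.DiskEmbedding) {D : Finset E} {c c' : V ⊕ Fin n}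
    {z : ℂ} (hz : z ∈ φ.region D c) (hz' : z ∈ φ.region D c') : N.Conn D c c' := by
  obtain ⟨v, hv, h⟩ := hz
  obtain ⟨v', hv', h'⟩ := hz'
  refine hv.trans (Conn.trans ?_ hv'.symm)
  obtain rfl | ⟨e, he, rfl, t, rfl⟩ := h <;> obtain h' | ⟨e', he', rfl, t', h'⟩ := h'
  · rw [φ.pos_injective h']
    exact Conn.refl _ _
  · exact (φ.conn_of_arc_eq_pos he' h'.symm).symm
  · exact φ.conn_of_arc_eq_pos he h'
  · by_cases hee : e = e'
    · subst hee
      exact Conn.refl _ _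
    obtain ⟨h0 | h0, -⟩ := φ.arc_eq_arc e e' t t' hee h'
    · subst h0
      rw [Path.source] at h'
      exact (φ.conn_of_arc_eq_pos he' h'.symm).symm
    · subst h0
      rw [Path.target] at h'
      exact (conn_ends he).trans (φ.conn_of_arc_eq_pos he' h'.symm).symm

/-- Connections between interlacing pairs of boundary vertices lie in the same component. -/
theorem DiskEmbedding.conn_of_interlace (φ : N.DiskEmbedding) {D : Finset E} {a b c d : Fin n}
    (hab : a < b) (hbc : b < c) (hcd : c < d) (hac : N.Conn D (Sum.inr a) (Sum.inr c))
    (hbd : N.Conn D (Sum.inr b) (Sum.inr d)) : N.Conn D (Sum.inr a) (Sum.inr b) := by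
  have h1 := φ.joinedIn_region hac (Conn.refl D _)
  have h2 := φ.joinedIn_region hbd (Conn.refl D _)
  simp only [φ.pos_boundary] at h1 h2
  obtain ⟨z, hz, hz'⟩ := exists_mem_inter_of_interlace (φ.angle_strictAnti hab)
    (φ.angle_strictAnti hbc) (φ.angle_strictAnti hcd) (φ.angle_sub_lt a d)
    (fun _ => φ.norm_le_of_mem_region) (fun _ => φ.norm_le_of_mem_region) h1 h2
  exact φ.conn_of_mem_region hz hz'

/-! ### Dimer configurations and their boundary subsets. -/

variable (N) in
/-- The edge at a boundary vertex. -/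
noncomputable def edgeAt (i : Fin n) : E := (N.boundary_degree i).choose

theorem incident_inr_iff {e : E} {i : Fin n} : N.Incident e (Sum.inr i) ↔ e = N.edgeAt i :=
  ⟨fun h => (N.boundary_degree i).choose_spec.2 e h,
    fun h => h ▸ (N.boundary_degree i).choose_spec.1⟩

theorem used_iff {P : Finset E} {i : Fin n} : N.Used P i ↔ N.edgeAt i ∈ P := by
  simp [Used, incident_inr_iff]

/-- In this colour-free form, toggling the edge at `i` toggles membership of `i`. -/
theorem mem_boundarySubset {P : Finset E} {i : Fin n} :
    i ∈ N.boundarySubset P ↔ (N.isBlack (Sum.inr i) = true ↔ N.edgeAt i ∈ P) := by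
  simp only [boundarySubset, Finset.mem_filter, Finset.mem_univ, true_and, used_iff]
  cases N.isBlack (Sum.inr i) <;> simp

theorem edgeAt_mem_symmDiff_iff [DecidableEq E] {P Q : Finset E} {i : Fin n} :
    N.edgeAt i ∈ symmDiff P Q ↔ ¬ (i ∈ N.boundarySubset P ↔ i ∈ N.boundarySubset Q) := by
  rw [mem_boundarySubset, mem_boundarySubset, Finset.mem_symmDiff]
  tauto

theorem blackEnd_ne_whiteEnd (e e' : E) : N.blackEnd e ≠ N.whiteEnd e' := fun h => by
  have := N.isBlack_blackEnd e
  rw [h, N.isBlack_whiteEnd] at this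
  exact Bool.false_ne_true this

theorem IsDimer.eq_of_incident {P : Finset E} (hP : N.IsDimer P) {e e' : E} (he : e ∈ P)
    (he' : e' ∈ P) {v : V ⊕ Fin n} (hv : N.Incident e v) (hv' : N.Incident e' v) : e = e' := by
  rcases v with v | i
  · exact (hP v).unique ⟨he, hv⟩ ⟨he', hv'⟩
  · rw [incident_inr_iff] at hv hv'
    rw [hv, hv']

section card

variable [Fintype V]

open Classical in
-- Every edge has exactly one end of colour `c`, so `P` is in bijection with the vertices of that
-- colour that it uses. Counting by black and by white ends gives the size of the boundary subset.
theorem IsDimer.card_eq_of_end {P : Finset E} (hP : N.IsDimer P) (f : E → V ⊕ Fin n) (c : Bool)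
    (hf : ∀ e, N.Incident e (f e)) (hc : ∀ e, N.isBlack (f e) = c)
    (hfc : ∀ e x, N.Incident e x → N.isBlack x = c → f e = x) :
    P.card = Finset.card {v : V | N.isBlack (Sum.inl v) = c} +
      Finset.card {i : Fin n | N.isBlack (Sum.inr i) = c ∧ N.Used P i} := by
  rw [← Finset.card_disjSum]
  refine Finset.card_nbij f ?_ ?_ ?_
  · intro e he
    have h1 := hf e
    have h2 := hc e
    rcases hfe : f e with v | i <;> rw [hfe] at h1 h2
    · simpa [Finset.inl_mem_disjSum] using h2
    · simpa [Finset.inr_mem_disjSum] using ⟨h2, e, he, h1⟩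
  · intro e he e' he' h
    exact hP.eq_of_incident he he' (hf e) (h ▸ hf e')
  · rintro (v | i) h
    · obtain ⟨e, ⟨he, hev⟩, -⟩ := hP v
      exact ⟨e, he, hfc e _ hev (by simpa [Finset.inl_mem_disjSum] using h)⟩
    · have h' : N.isBlack (Sum.inr i) = c ∧ N.Used P i := by
        simpa [Finset.inr_mem_disjSum] using h
      obtain ⟨hi, e, he, hei⟩ := h'
      exact ⟨e, he, hfc e _ hei hi⟩

/-- The boundary subset of every dimer configuration has `rankInt` elements. -/
theorem IsDimer.card_boundarySubset {P : Finset E} (hP : N.IsDimer P) :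
    ((N.boundarySubset P).card : ℤ) = N.rankInt := by
  classical
  have hb := hP.card_eq_of_end N.blackEnd true (fun _ => Or.inl rfl) N.isBlack_blackEnd
    (fun e x hx hc => hx.resolve_right fun h => by
      rw [← h, N.isBlack_whiteEnd] at hc; exact Bool.false_ne_true hc)
  have hw := hP.card_eq_of_end N.whiteEnd false (fun _ => Or.inr rfl) N.isBlack_whiteEnd
    (fun e x hx hc => hx.resolve_left fun h => by
      rw [← h, N.isBlack_blackEnd] at hc; exact Bool.false_ne_true hc.symm)
  have h1 : (N.boundarySubset P).card =
      Finset.card {i : Fin n | N.isBlack (Sum.inr i) = true ∧ N.Used P i} +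
      Finset.card {i : Fin n | N.isBlack (Sum.inr i) = false ∧ ¬ N.Used P i} := by
    rw [← Finset.card_union_of_disjoint, ← Finset.filter_or]
    · unfold boundarySubset
      congr
    · rw [Finset.disjoint_filter]
      rintro i - ⟨h, -⟩ ⟨h', -⟩
      rw [h] at h'
      exact Bool.false_ne_true h'.symm
  have h2 : Finset.card {i : Fin n | N.isBlack (Sum.inr i) = false} =
      Finset.card {i : Fin n | N.isBlack (Sum.inr i) = false ∧ N.Used P i} +
      Finset.card {i : Fin n | N.isBlack (Sum.inr i) = false ∧ ¬ N.Used P i} := by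
    rw [← Finset.filter_filter, ← Finset.filter_filter,
      Finset.card_filter_add_card_filter_not]
  rw [rankInt, h1, h2]
  push_cast
  omega

end card

/-! ### Superposition of two dimer configurations. -/

section mate

open Classical in
/-- The endpoint of `e` other than `v`. -/
noncomputable def otherEnd (N : BipartiteNetwork n V E) (e : E) (v : V ⊕ Fin n) : V ⊕ Fin n :=
  if N.blackEnd e = v then N.whiteEnd e else N.blackEnd e

open Classical in
/-- The vertex joined to `v` by an edge in `M`, or `v` itself if there is none. -/
noncomputable def mate (N : BipartiteNetwork n V E) (M : Finset E) (v : V ⊕ Fin n) : V ⊕ Fin n :=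
  if h : ∃ e ∈ M, N.Incident e v then N.otherEnd h.choose v else v

variable {M : Finset E}

theorem mate_eq_otherEnd
    (hM : ∀ e ∈ M, ∀ e' ∈ M, ∀ v, N.Incident e v → N.Incident e' v → e = e') {e : E} (he : e ∈ M)
    {v : V ⊕ Fin n} (hv : N.Incident e v) : N.mate M v = N.otherEnd e v := by
  have h : ∃ e ∈ M, N.Incident e v := ⟨e, he, hv⟩
  rw [mate, dif_pos h, hM _ h.choose_spec.1 _ he v h.choose_spec.2 hv]

theorem mate_blackEnd
    (hM : ∀ e ∈ M, ∀ e' ∈ M, ∀ v, N.Incident e v → N.Incident e' v → e = e') {e : E} (he : e ∈ M) :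
    N.mate M (N.blackEnd e) = N.whiteEnd e := by
  rw [mate_eq_otherEnd hM he (Or.inl rfl), otherEnd, if_pos rfl]

theorem mate_whiteEnd
    (hM : ∀ e ∈ M, ∀ e' ∈ M, ∀ v, N.Incident e v → N.Incident e' v → e = e') {e : E} (he : e ∈ M) :
    N.mate M (N.whiteEnd e) = N.blackEnd e := by
  rw [mate_eq_otherEnd hM he (Or.inr rfl), otherEnd, if_neg (blackEnd_ne_whiteEnd e e)]

theorem mate_mate
    (hM : ∀ e ∈ M, ∀ e' ∈ M, ∀ v, N.Incident e v → N.Incident e' v → e = e') (v : V ⊕ Fin n) :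
    N.mate M (N.mate M v) = v := by
  by_cases h : ∃ e ∈ M, N.Incident e v
  · obtain ⟨e, he, rfl | rfl⟩ := h
    · rw [mate_blackEnd hM he, mate_whiteEnd hM he]
    · rw [mate_whiteEnd hM he, mate_blackEnd hM he]
  · have h' : N.mate M v = v := dif_neg h
    rw [h', h']

end mate

open Classical in
/-- The edges of `D` in the component of a vertex. -/
noncomputable def component (N : BipartiteNetwork n V E) (D : Finset E) (c : V ⊕ Fin n) :
    Finset E :=
  {e ∈ D | N.Conn D c (N.blackEnd e)}

theorem component_subset {D : Finset E} {c : V ⊕ Fin n} : N.component D c ⊆ D := fun e he => by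
  simp only [component, Finset.mem_filter] at he
  exact he.1

theorem mem_component {D : Finset E} {c v : V ⊕ Fin n} {e : E} (he : e ∈ D)
    (hv : N.Incident e v) : e ∈ N.component D c ↔ N.Conn D c v := by
  simp only [component, Finset.mem_filter, he, true_and]
  rcases hv with rfl | rfl
  · rfl
  · exact ⟨fun h => h.trans (conn_ends he), fun h => h.trans (conn_ends he).symm⟩

theorem component_eq_of_conn {D : Finset E} {c c' : V ⊕ Fin n} (h : N.Conn D c c') :
    N.component D c = N.component D c' := by
  ext e
  simp only [component, Finset.mem_filter]
  exact and_congr_right fun _ => ⟨fun h' => h.symm.trans h', fun h' => h.trans h'⟩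

variable [DecidableEq E] {P Q : Finset E}

/-- A component of the superposition of two dimer configurations has at most two boundary
vertices. -/
theorem IsDimer.eq_of_conn_boundary (hP : N.IsDimer P) (hQ : N.IsDimer Q) {a i j : Fin n}
    (ha : N.edgeAt a ∈ symmDiff P Q) (hi : N.edgeAt i ∈ symmDiff P Q)
    (hj : N.edgeAt j ∈ symmDiff P Q) (hai : N.Conn (symmDiff P Q) (Sum.inr a) (Sum.inr i))
    (haj : N.Conn (symmDiff P Q) (Sum.inr a) (Sum.inr j)) (hia : i ≠ a) (hja : j ≠ a) : i = j := by
  have hMP : ∀ e ∈ P \ Q, ∀ e' ∈ P \ Q, ∀ v, N.Incident e v → N.Incident e' v → e = e' :=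
    fun e he e' he' v => hP.eq_of_incident (Finset.mem_sdiff.1 he).1 (Finset.mem_sdiff.1 he').1
  have hMQ : ∀ e ∈ Q \ P, ∀ e' ∈ Q \ P, ∀ v, N.Incident e v → N.Incident e' v → e = e' :=
    fun e he e' he' v => hQ.eq_of_incident (Finset.mem_sdiff.1 he).1 (Finset.mem_sdiff.1 he').1
  -- `β * α` moves two steps along the alternating paths of the superposition. The only edge at a
  -- boundary vertex lies in one of the two matchings, so the other involution fixes that vertex
  -- (`flag`).
  let α : Equiv.Perm (V ⊕ Fin n) := Function.Involutive.toPerm _ (mate_mate hMP)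
  let β : Equiv.Perm (V ⊕ Fin n) := Function.Involutive.toPerm _ (mate_mate hMQ)
  have hα : ∀ v, α (α v) = v := mate_mate hMP
  have hβ : ∀ v, β (β v) = v := mate_mate hMQ
  have flag : ∀ b, N.edgeAt b ∈ symmDiff P Q → α (Sum.inr b) = Sum.inr b ∨
      β (Sum.inr b) = Sum.inr b := fun b hb => by
    have hn : ∀ M : Finset E, N.edgeAt b ∉ M → N.mate M (Sum.inr b) = Sum.inr b := fun M h =>
      dif_neg (by rintro ⟨e, he, h'⟩; exact h (incident_inr_iff.1 h' ▸ he))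
    rcases Finset.mem_symmDiff.1 hb with h | h
    · exact Or.inr (hn _ (by simp [h]))
    · exact Or.inl (hn _ (by simp [h]))
  have hcyc : ∀ u v, N.Conn (symmDiff P Q) u v →
      ((β * α).SameCycle (Sum.inr a) u ↔ (β * α).SameCycle (Sum.inr a) v) := fun u v h => by
    induction h with
    | rel u v h =>
      obtain ⟨e, he, rfl, rfl⟩ := h
      rcases Finset.mem_symmDiff.1 he with h | h
      · rw [← Finset.mem_sdiff] at h
        have h1 : α (N.blackEnd e) = N.whiteEnd e := mate_blackEnd hMP h
        have h2 : α (N.whiteEnd e) = N.blackEnd e := mate_whiteEnd hMP h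
        exact ⟨fun h => h1 ▸ Equiv.Perm.sameCycle_involution_left hα hβ (flag a ha) h,
          fun h => h2 ▸ Equiv.Perm.sameCycle_involution_left hα hβ (flag a ha) h⟩
      · rw [← Finset.mem_sdiff] at h
        have h1 : β (N.blackEnd e) = N.whiteEnd e := mate_blackEnd hMQ h
        have h2 : β (N.whiteEnd e) = N.blackEnd e := mate_whiteEnd hMQ h
        exact ⟨fun h => h1 ▸ Equiv.Perm.sameCycle_involution_right hα hβ (flag a ha) h,
          fun h => h2 ▸ Equiv.Perm.sameCycle_involution_right hα hβ (flag a ha) h⟩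
    | refl u => rfl
    | symm u v _ ih => exact ih.symm
    | trans u v w _ _ ih ih' => exact ih.trans ih'
  exact Sum.inr_injective (Equiv.Perm.eq_of_sameCycle_of_fixed hα hβ (flag a ha) (flag i hi)
    (flag j hj) ((hcyc _ _ hai).1 (Equiv.Perm.SameCycle.refl _ _))
    ((hcyc _ _ haj).1 (Equiv.Perm.SameCycle.refl _ _)) (by simpa using hia) (by simpa using hja))

/-- At an interior vertex the new set agrees with `Q` if the vertex lies in the component, and with
`P` otherwise. -/
theorem IsDimer.symmDiff_component (hP : N.IsDimer P) (hQ : N.IsDimer Q) (c : V ⊕ Fin n) :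
    N.IsDimer (symmDiff P (N.component (symmDiff P Q) c)) := by
  intro v
  classical
  obtain ⟨p, ⟨hp, hpv⟩, hpu⟩ := hP v
  obtain ⟨q, ⟨hq, hqv⟩, hqu⟩ := hQ v
  have key : ∀ e, N.Incident e (Sum.inl v) → (e ∈ symmDiff P (N.component (symmDiff P Q) c) ↔
      if N.Conn (symmDiff P Q) c (Sum.inl v) then e ∈ Q else e ∈ P) := fun e hev => by
    have h1 : e ∈ symmDiff P Q →
      (e ∈ N.component (symmDiff P Q) c ↔ N.Conn (symmDiff P Q) c (Sum.inl v)) :=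
      fun he => mem_component he hev
    have h2 : e ∈ N.component (symmDiff P Q) c → e ∈ symmDiff P Q := fun h => component_subset h
    rw [Finset.mem_symmDiff] at h1 h2 ⊢
    split_ifs <;> tauto
  by_cases hc : N.Conn (symmDiff P Q) c (Sum.inl v)
  · simp only [hc, if_true] at key
    exact ⟨q, ⟨(key q hqv).2 hq, hqv⟩, fun e he => hqu e ⟨(key e he.2).1 he.1, he.2⟩⟩
  · simp only [hc, if_false] at key
    exact ⟨p, ⟨(key p hpv).2 hp, hpv⟩, fun e he => hpu e ⟨(key e he.2).1 he.1, he.2⟩⟩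

theorem mem_boundarySubset_symmDiff {K : Finset E} {i : Fin n} :
    i ∈ N.boundarySubset (symmDiff P K) ↔ ¬ (i ∈ N.boundarySubset P ↔ N.edgeAt i ∈ K) := by
  rw [mem_boundarySubset, mem_boundarySubset, Finset.mem_symmDiff]
  tauto

/-- Otherwise exchanging along the component of `x` would only remove elements from the boundary
subset of `P`, among them `x`, although all dimer configurations have boundary subsets of the same
size. -/
theorem IsDimer.exists_conn_boundary [Fintype V] (hP : N.IsDimer P) (hQ : N.IsDimer Q) {x : Fin n}
    (hx : x ∈ N.boundarySubset P) (hx' : x ∉ N.boundarySubset Q) :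
    ∃ y, y ∉ N.boundarySubset P ∧ y ∈ N.boundarySubset Q ∧
      N.Conn (symmDiff P Q) (Sum.inr x) (Sum.inr y) := by
  by_contra hno
  push Not at hno
  have hsub : N.boundarySubset (symmDiff P (N.component (symmDiff P Q) (Sum.inr x))) ⊂
      N.boundarySubset P := by
    have hmem : ∀ i, N.edgeAt i ∈ N.component (symmDiff P Q) (Sum.inr x) ↔
        ¬ (i ∈ N.boundarySubset P ↔ i ∈ N.boundarySubset Q) ∧
          N.Conn (symmDiff P Q) (Sum.inr x) (Sum.inr i) := fun i => by
      rw [← edgeAt_mem_symmDiff_iff]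
      exact ⟨fun h => ⟨component_subset h,
        (mem_component (component_subset h) (incident_inr_iff.2 rfl)).1 h⟩,
        fun h => (mem_component h.1 (incident_inr_iff.2 rfl)).2 h.2⟩
    rw [Finset.ssubset_iff_of_subset]
    · refine ⟨x, hx, ?_⟩
      rw [mem_boundarySubset_symmDiff, hmem]
      have := Conn.refl (N := N) (symmDiff P Q) (Sum.inr x)
      tauto
    · intro i hi
      rw [mem_boundarySubset_symmDiff, hmem] at hi
      have := hno i
      tauto
  have h := Finset.card_lt_card hsub
  have h1 := hP.card_boundarySubset
  have h2 := (hP.symmDiff_component hQ (Sum.inr x)).card_boundarySubset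
  omega

open Classical in
/-- The other boundary vertex in the component of a boundary vertex. -/
noncomputable def partner (N : BipartiteNetwork n V E) (D : Finset E) (x : Fin n) : Fin n :=
  if h : ∃ y, y ≠ x ∧ N.edgeAt y ∈ D ∧ N.Conn D (Sum.inr x) (Sum.inr y) then h.choose else x

theorem IsDimer.partner_spec [Fintype V] (hP : N.IsDimer P) (hQ : N.IsDimer Q) {x : Fin n}
    (hx : N.edgeAt x ∈ symmDiff P Q) :
    N.partner (symmDiff P Q) x ≠ x ∧ N.edgeAt (N.partner (symmDiff P Q) x) ∈ symmDiff P Q ∧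
      N.Conn (symmDiff P Q) (Sum.inr x) (Sum.inr (N.partner (symmDiff P Q) x)) := by
  have h : ∃ y, y ≠ x ∧ N.edgeAt y ∈ symmDiff P Q ∧
      N.Conn (symmDiff P Q) (Sum.inr x) (Sum.inr y) := by
    have hx' := edgeAt_mem_symmDiff_iff.1 hx
    by_cases hxP : x ∈ N.boundarySubset P
    · obtain ⟨y, h1, h2, h3⟩ := hP.exists_conn_boundary hQ hxP (by tauto)
      exact ⟨y, fun h => h1 (h ▸ hxP), edgeAt_mem_symmDiff_iff.2 (by tauto), h3⟩
    · obtain ⟨y, h1, h2, h3⟩ := hQ.exists_conn_boundary hP (x := x) (by tauto) hxP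
      rw [symmDiff_comm] at h3
      exact ⟨y, fun h => hxP (h ▸ h2), edgeAt_mem_symmDiff_iff.2 (by tauto), h3⟩
  rw [partner, dif_pos h]
  exact h.choose_spec

theorem IsDimer.eq_partner [Fintype V] (hP : N.IsDimer P) (hQ : N.IsDimer Q) {x y : Fin n}
    (hx : N.edgeAt x ∈ symmDiff P Q) (hy : N.edgeAt y ∈ symmDiff P Q) (hyx : y ≠ x)
    (h : N.Conn (symmDiff P Q) (Sum.inr x) (Sum.inr y)) : y = N.partner (symmDiff P Q) x :=
  have h' := hP.partner_spec hQ hx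
  hP.eq_of_conn_boundary hQ hx hy h'.2.1 h h'.2.2 hyx h'.1

theorem IsDimer.partner_partner [Fintype V] (hP : N.IsDimer P) (hQ : N.IsDimer Q) {x : Fin n}
    (hx : N.edgeAt x ∈ symmDiff P Q) :
    N.partner (symmDiff P Q) (N.partner (symmDiff P Q) x) = x :=
  have h := hP.partner_spec hQ hx
  (hP.eq_partner hQ h.2.1 hx h.1.symm h.2.2.symm).symm

theorem IsDimer.partner_mem_boundarySubset [Fintype V] (hP : N.IsDimer P) (hQ : N.IsDimer Q)
    {x : Fin n} (hx : x ∈ N.boundarySubset P) (hx' : x ∉ N.boundarySubset Q) :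
    N.partner (symmDiff P Q) x ∉ N.boundarySubset P ∧
      N.partner (symmDiff P Q) x ∈ N.boundarySubset Q := by
  obtain ⟨y, h1, h2, h3⟩ := hP.exists_conn_boundary hQ hx hx'
  have hyx : y ≠ x := fun h => h1 (h ▸ hx)
  rw [← hP.eq_partner hQ (edgeAt_mem_symmDiff_iff.2 (by tauto))
    (edgeAt_mem_symmDiff_iff.2 (by tauto)) hyx h3]
  exact ⟨h1, h2⟩

theorem IsDimer.edgeAt_mem_component_iff [Fintype V] (hP : N.IsDimer P) (hQ : N.IsDimer Q)
    {x i : Fin n} (hx : N.edgeAt x ∈ symmDiff P Q) :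
    N.edgeAt i ∈ N.component (symmDiff P Q) (Sum.inr x) ↔
      i = x ∨ i = N.partner (symmDiff P Q) x := by
  have h' := hP.partner_spec hQ hx
  constructor
  · intro h
    by_cases hix : i = x
    · exact Or.inl hix
    · exact Or.inr (hP.eq_partner hQ hx (component_subset h) hix
        ((mem_component (component_subset h) (incident_inr_iff.2 rfl)).1 h))
  · rintro (rfl | rfl)
    · exact (mem_component hx (incident_inr_iff.2 rfl)).2 (Conn.refl _ _)
    · exact (mem_component h'.2.1 (incident_inr_iff.2 rfl)).2 h'.2.2

theorem symmDiff_symmDiff_component {c : V ⊕ Fin n} :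
    symmDiff (symmDiff P (N.component (symmDiff P Q) c))
      (symmDiff Q (N.component (symmDiff P Q) c)) = symmDiff P Q := by
  rw [symmDiff_symmDiff_symmDiff_comm, symmDiff_self, symmDiff_bot]

/-- Edges of `K` only change sides, so the union and the intersection of the two sets are preserved.
-/
theorem prod_symmDiff_mul_prod_symmDiff {R : Type*} [CommMonoid R] (w : E → R) {K : Finset E}
    (hK : K ⊆ symmDiff P Q) :
    (∏ e ∈ symmDiff P K, w e) * ∏ e ∈ symmDiff Q K, w e = (∏ e ∈ P, w e) * ∏ e ∈ Q, w e := by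
  have hK' : ∀ e, e ∈ K → e ∈ symmDiff P Q := fun e he => hK he
  simp only [Finset.mem_symmDiff] at hK'
  rw [← Finset.prod_union_inter, ← Finset.prod_union_inter (s₁ := P)]
  congr 1 <;> refine Finset.prod_congr ?_ fun _ _ => rfl <;> ext e <;> have := hK' e <;>
    simp only [Finset.mem_union, Finset.mem_inter, Finset.mem_symmDiff] <;> tauto

/-- The components of a superposition do not cross: a pair of partners separates no other pair. -/
theorem IsDimer.even_card_between [Fintype V] (φ : N.DiskEmbedding) (hP : N.IsDimer P)
    (hQ : N.IsDimer Q) {a b : Fin n} (ha : N.edgeAt a ∈ symmDiff P Q)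
    (hb : b = N.partner (symmDiff P Q) a) :
    Even (Finset.card {z : Fin n | a < z ∧ z < b ∧ N.edgeAt z ∈ symmDiff P Q}) := by
  have ha' := hP.partner_spec hQ ha
  rw [← hb] at ha'
  -- Evenness follows from the fixed-point-free involution z ↦ partner of z; a partner outside the
  -- interval would make two components cross.
  rw [← ZMod.natCast_eq_zero_iff_even, Finset.cast_card]
  refine Finset.sum_involution (fun z _ => N.partner (symmDiff P Q) z) (fun _ _ => by decide)
    (fun z hz _ => ?_) (fun z hz => ?_) (fun z hz => ?_)
  · rw [Finset.mem_filter] at hz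
    exact (hP.partner_spec hQ hz.2.2.2).1
  · simp only [Finset.mem_filter, Finset.mem_univ, true_and] at hz ⊢
    obtain ⟨haz, hzb, hz⟩ := hz
    obtain ⟨hne, hmem, hconn⟩ := hP.partner_spec hQ hz
    have hno : ¬ N.Conn (symmDiff P Q) (Sum.inr a) (Sum.inr z) := fun h => by
      have := hP.eq_partner hQ ha hz haz.ne' h
      exact hzb.ne (this.trans hb.symm)
    set w := N.partner (symmDiff P Q) z with hw
    have hwa : w ≠ a := fun h => hno (h ▸ hconn.symm)
    have hwb : w ≠ b := fun h => hno (ha'.2.2.trans (h ▸ hconn.symm))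
    refine ⟨?_, ?_, hmem⟩
    · by_contra h
      have h' : w < a := lt_of_le_of_ne (not_lt.1 h) hwa
      exact hno ((φ.conn_of_interlace h' haz hzb hconn.symm ha'.2.2).symm.trans hconn.symm)
    · by_contra h
      have h' : b < w := lt_of_le_of_ne (not_lt.1 h) hwb.symm
      exact hno (φ.conn_of_interlace haz hzb h' ha'.2.2 hconn)
  · rw [Finset.mem_filter] at hz
    exact hP.partner_partner hQ hz.2.2.2

end BipartiteNetwork

/-! ### Signs in the Plücker relations. -/

/-- Modulo 2, a point strictly between `x` and `y` counts once for each of `I` and `J` containing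
it, points outside the interval count evenly, `x` counts once as an element of `J`, and `y` not at
all. -/
theorem odd_card_add_card_of_lt {n : ℕ} {I J : Finset (Fin n)} {x y : Fin n} (hxy : x < y)
    (hyI : y ∉ I) (hxJ : x ∈ J)
    (h : Even (Finset.card {z : Fin n | x < z ∧ z < y ∧ ¬ (z ∈ I ↔ z ∈ J)})) :
    Odd ((Finset.card {z : Fin n | z ∈ I ∧ x < z} + Finset.card {z : Fin n | z ∈ J ∧ z < x}) +
      (Finset.card {z : Fin n | z ∈ I ∧ y < z} + Finset.card {z : Fin n | z ∈ J ∧ z < y})) := by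
  have key : ∀ z : Fin n, ((if z ∈ I ∧ x < z then 1 else 0) + (if z ∈ J ∧ z < x then 1 else 0) +
      ((if z ∈ I ∧ y < z then 1 else 0) + (if z ∈ J ∧ z < y then 1 else 0)) : ℕ) =
      (if z = x then 1 else 0) + (if x < z ∧ z < y ∧ ¬ (z ∈ I ↔ z ∈ J) then 1 else 0) +
      2 * ((if z < x ∧ z ∈ J then 1 else 0) + (if y < z ∧ z ∈ I then 1 else 0) +
        (if x < z ∧ z < y ∧ z ∈ I ∧ z ∈ J then 1 else 0)) := fun z => by
    grind
  have hsum := Finset.sum_congr (rfl : (Finset.univ : Finset (Fin n)) = Finset.univ)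
    fun z _ => key z
  simp only [Finset.sum_add_distrib, ← Finset.mul_sum, ← Finset.card_filter,
    Finset.filter_eq', Finset.mem_univ, if_true, Finset.card_singleton] at hsum
  rw [hsum]
  exact ((odd_one.add_even h)).add_even (even_two_mul _)

/-- The Plücker relations with a repeated index among `j₁, …, j_{k+1}` hold trivially. -/
theorem sum_antisymExt_eq_zero_of_not_injective {n m : ℕ} (p : KSubset n (m + 1) → ℝ)
    (i : Fin m → Fin n) {j : Fin (m + 2) → Fin n} (hj : ¬ Function.Injective j) :
    ∑ r : Fin (m + 2), (-1 : ℝ) ^ (r : ℕ)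
      * antisymExt p (Fin.snoc i (j r) : Fin (m + 1) → Fin n)
      * antisymExt p (j ∘ r.succAbove) = 0 := by
  obtain ⟨a, b, hab, hlt⟩ : ∃ a b, j a = j b ∧ a < b := by
    simp only [Function.Injective, not_forall] at hj
    obtain ⟨a, b, h, hne⟩ := hj
    rcases lt_or_gt_of_ne hne with h' | h'
    · exact ⟨a, b, h, h'⟩
    · exact ⟨b, a, h.symm, h'⟩
  -- Deleting any other position leaves the repetition in place, so only `a` and `b` can contribute.
  rw [Fintype.sum_eq_add a b hlt.ne]
  · have himg : ∀ c d, j c = j d → c ≠ d →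
        Finset.univ.image (j ∘ c.succAbove) = Finset.univ.image j := fun c d h hne => by
      ext z
      simp only [Finset.mem_image, Finset.mem_univ, true_and, Function.comp]
      refine ⟨fun ⟨t, ht⟩ => ⟨_, ht⟩, fun ⟨t, ht⟩ => ?_⟩
      by_cases htc : t = c
      · obtain ⟨u, hu⟩ := Fin.exists_succAbove_eq hne.symm
        exact ⟨u, by rw [hu, ← h, ← htc, ht]⟩
      · obtain ⟨u, hu⟩ := Fin.exists_succAbove_eq htc
        exact ⟨u, by rw [hu, ht]⟩
    have ha := himg a b hab hlt.ne
    have hb := himg b a hab.symm hlt.ne'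
    by_cases hinj : Function.Injective (j ∘ a.succAbove)
    · have hinj' : Function.Injective (j ∘ b.succAbove) := by
        rw [← card_image_univ_eq_iff_injective] at hinj ⊢
        rw [hb, ← ha, hinj]
      rw [antisymExt_of_injective p hinj, antisymExt_of_injective p hinj', ← hab]
      -- The signs for `a` and `b` differ only through the count of earlier equal entries, which is
      -- 0 for `a` and 1 for `b`.
      have h1 : Finset.card {t | t < a ∧ j t = j a} = 0 := by
        rw [Finset.card_eq_zero, Finset.filter_eq_empty_iff]
        rintro t - ⟨hta, h⟩
        obtain ⟨u, rfl⟩ := Fin.exists_succAbove_eq hta.ne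
        obtain ⟨v, rfl⟩ := Fin.exists_succAbove_eq hlt.ne'
        have := hinj (h.trans hab)
        subst this
        exact lt_asymm hta hlt
      have h2 : Finset.card {t | t < b ∧ j t = j b} = 1 := by
        rw [Finset.card_eq_one]
        refine ⟨a, ?_⟩
        ext t
        simp only [Finset.mem_filter, Finset.mem_univ, true_and, Finset.mem_singleton]
        refine ⟨fun ⟨htb, h⟩ => ?_, fun h => h ▸ ⟨hlt, hab⟩⟩
        obtain ⟨u, rfl⟩ := Fin.exists_succAbove_eq htb.ne
        obtain ⟨v, rfl⟩ := Fin.exists_succAbove_eq hlt.ne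
        rw [hinj' (h.trans hab.symm)]
      have e1 := neg_one_pow_mul_inversionCount_succAbove j a
      have e2 := neg_one_pow_mul_inversionCount_succAbove j b
      rw [h1] at e1
      rw [h2, ← hab, pow_succ, ← add_zero (inversionCount j + _), ← e1] at e2
      simp only [ha, hb]
      linear_combination (antisymExt p (Fin.snoc i (j a) : Fin (m + 1) → Fin n)) *
        p ⟨Finset.univ.image j, _⟩ * e2
    · have hinj' : ¬ Function.Injective (j ∘ b.succAbove) := by
        rw [← card_image_univ_eq_iff_injective] at hinj ⊢
        rwa [hb, ← ha]
      rw [antisymExt_of_not_injective p hinj, antisymExt_of_not_injective p hinj']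
      ring
  · rintro r ⟨hra, hrb⟩
    rw [antisymExt_of_not_injective p (f := j ∘ r.succAbove), mul_zero]
    intro hinj
    obtain ⟨u, hu⟩ := Fin.exists_succAbove_eq hra.symm
    obtain ⟨v, hv⟩ := Fin.exists_succAbove_eq hrb.symm
    have : u = v := hinj (by simp only [Function.comp, hu, hv, hab])
    exact hlt.ne (by rw [← hu, ← hv, this])

theorem Fin.snoc_injective_iff_notMem {n m : ℕ} {i : Fin m → Fin n} (hi : Function.Injective i)
    {x : Fin n} : Function.Injective (Fin.snoc i x : Fin (m + 1) → Fin n) ↔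
      x ∉ Finset.univ.image i := by
  simp [Fin.snoc_injective_iff, hi]

theorem card_lt_filter_image {n l : ℕ} {f : Fin l → Fin n} (hf : Function.Injective f)
    (P : Fin n → Prop) [DecidablePred P] :
    Finset.card {t | P (f t)} = Finset.card {z : Fin n | z ∈ Finset.univ.image f ∧ P z} := by
  rw [← Finset.card_image_of_injective _ hf]
  congr 1
  ext z
  simp only [Finset.mem_image, Finset.mem_filter, Finset.mem_univ, true_and]
  constructor
  · rintro ⟨t, ht, rfl⟩
    exact ⟨⟨t, rfl⟩, ht⟩
  · rintro ⟨⟨t, rfl⟩, ht⟩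
    exact ⟨t, ht, rfl⟩

theorem image_univ_snoc {n m : ℕ} (i : Fin m → Fin n) (x : Fin n) :
    Finset.univ.image (Fin.snoc i x : Fin (m + 1) → Fin n) = insert x (Finset.univ.image i) := by
  ext z
  simp [Fin.exists_fin_succ', eq_comm, or_comm]

theorem image_univ_succAbove {n l : ℕ} {j : Fin (l + 1) → Fin n} (hj : Function.Injective j)
    (r : Fin (l + 1)) :
    Finset.univ.image (j ∘ r.succAbove) = (Finset.univ.image j).erase (j r) := by
  ext z
  simp only [Finset.mem_image, Finset.mem_univ, true_and, Finset.mem_erase, Function.comp]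
  constructor
  · rintro ⟨t, rfl⟩
    exact ⟨fun h => Fin.succAbove_ne r t (hj h), _, rfl⟩
  · rintro ⟨hne, t, rfl⟩
    obtain ⟨u, rfl⟩ := Fin.exists_succAbove_eq (x := t) (y := r) (fun h => hne (by rw [h]))
    exact ⟨u, rfl⟩

/-- The sign of the term of index `r` in a Plücker relation. -/
theorem plucker_sign {n m : ℕ} {i : Fin m → Fin n} {j : Fin (m + 2) → Fin n}
    (hi : Function.Injective i) (hj : Function.Injective j) (r : Fin (m + 2)) :
    (-1 : ℝ) ^ (r : ℕ) * (-1) ^ inversionCount (Fin.snoc i (j r) : Fin (m + 1) → Fin n) *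
      (-1) ^ inversionCount (j ∘ r.succAbove) = (-1) ^ (inversionCount i + inversionCount j +
        (Finset.card {z : Fin n | z ∈ Finset.univ.image i ∧ j r < z} +
          Finset.card {z : Fin n | z ∈ Finset.univ.image j ∧ z < j r})) := by
  have h0 : Finset.card {t | t < r ∧ j t = j r} = 0 := by
    rw [Finset.card_eq_zero, Finset.filter_eq_empty_iff]
    rintro t - ⟨h, h'⟩
    exact h.ne (hj h')
  have h1 := neg_one_pow_mul_inversionCount_succAbove j r
  rw [h0, card_lt_filter_image hj (fun z => z < j r)] at h1
  rw [mul_right_comm, h1, inversionCount_snoc, card_lt_filter_image hi (fun z => j r < z),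
    ← pow_add]
  congr 1
  ring

theorem neg_one_pow_add_neg_one_pow_of_odd {a b : ℕ} (h : Odd (a + b)) :
    (-1 : ℝ) ^ a + (-1) ^ b = 0 := by
  rcases Nat.even_or_odd a with ha | ha
  · rw [ha.neg_one_pow, (Nat.odd_add'.1 h |>.2 ha).neg_one_pow]
    norm_num
  · rw [ha.neg_one_pow, (Nat.odd_add.1 h |>.1 ha).neg_one_pow]
    norm_num

/-! ### The sign-reversing involution. -/

namespace BipartiteNetwork

variable {n : ℕ} {V E : Type*} {N : BipartiteNetwork n V E}

/-- The component of `x` meets the boundary only in `x` and its partner `y`, which differ in the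
opposite sense, so the exchange replaces `x` by `y` in both boundary subsets. -/
theorem IsDimer.swap_component [Fintype V] [DecidableEq E] {P Q : Finset E} (hP : N.IsDimer P)
    (hQ : N.IsDimer Q) {I J : Finset (Fin n)} {x : Fin n} (hPI : N.boundarySubset P = insert x I)
    (hQJ : N.boundarySubset Q = J.erase x) (hxI : x ∉ I) (hxJ : x ∈ J) :
    let D := symmDiff P Q
    let y := N.partner D x
    let K := N.component D (Sum.inr x)
    y ≠ x ∧ y ∈ J ∧ y ∉ I ∧ N.boundarySubset (symmDiff P K) = insert y I ∧
      N.boundarySubset (symmDiff Q K) = J.erase y := by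
  intro D y K
  have hx : x ∈ N.boundarySubset P := by simp [hPI]
  have hx' : x ∉ N.boundarySubset Q := by simp [hQJ]
  have hxD : N.edgeAt x ∈ D := edgeAt_mem_symmDiff_iff.2 (by tauto)
  obtain ⟨h1, h2⟩ : y ∉ N.boundarySubset P ∧ y ∈ N.boundarySubset Q :=
    hP.partner_mem_boundarySubset hQ hx hx'
  have hK : ∀ z, N.edgeAt z ∈ K ↔ z = x ∨ z = y := fun z => hP.edgeAt_mem_component_iff hQ hxD
  rw [hPI, Finset.mem_insert, not_or] at h1
  rw [hQJ, Finset.mem_erase] at h2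
  refine ⟨h1.1, h2.2, h1.2, ?_, ?_⟩
  · ext z
    rw [mem_boundarySubset_symmDiff, hK, hPI, Finset.mem_insert, Finset.mem_insert]
    have := h1
    grind
  · ext z
    rw [mem_boundarySubset_symmDiff, hK, hQJ, Finset.mem_erase, Finset.mem_erase]
    have := h2
    grind

/-- Away from `x` the boundary subsets are `I` and `J`, so the points counted by `even_card_between`
are those in exactly one of them. The two cases are the two orders of `x` and `y`. -/
theorem IsDimer.odd_sign_exponent [Fintype V] [DecidableEq E] (φ : N.DiskEmbedding)
    {P Q : Finset E} (hP : N.IsDimer P)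
    (hQ : N.IsDimer Q) {I J : Finset (Fin n)} {x : Fin n} (hPI : N.boundarySubset P = insert x I)
    (hQJ : N.boundarySubset Q = J.erase x) (hxI : x ∉ I) (hxJ : x ∈ J) :
    let y := N.partner (symmDiff P Q) x
    Odd ((Finset.card {z : Fin n | z ∈ I ∧ x < z} + Finset.card {z : Fin n | z ∈ J ∧ z < x}) +
      (Finset.card {z : Fin n | z ∈ I ∧ y < z} + Finset.card {z : Fin n | z ∈ J ∧ z < y})) := by
  intro y
  have hxD : N.edgeAt x ∈ symmDiff P Q := by simp [edgeAt_mem_symmDiff_iff, hPI, hQJ]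
  obtain ⟨hyx, hyJ, hyI, -, -⟩ := hP.swap_component hQ hPI hQJ hxI hxJ
  obtain ⟨-, hyD, -⟩ := hP.partner_spec hQ hxD
  have hz : ∀ z, z ≠ x → (N.edgeAt z ∈ symmDiff P Q ↔ ¬ (z ∈ I ↔ z ∈ J)) := fun z hz => by
    simp [edgeAt_mem_symmDiff_iff, hPI, hQJ, hz]
  rcases lt_or_gt_of_ne hyx with h | h
  · rw [add_comm]
    refine odd_card_add_card_of_lt h hxI hyJ ?_
    have := hP.even_card_between φ hQ hyD (hP.partner_partner hQ hxD).symm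
    rwa [Finset.filter_congr fun z _ => and_congr_right fun _ => and_congr_right fun h' : z < x =>
      hz z h'.ne] at this
  · refine odd_card_add_card_of_lt h hyI hxJ ?_
    have := hP.even_card_between φ hQ hxD rfl
    rwa [Finset.filter_congr fun z _ => and_congr_right fun h' : x < z => and_congr_right fun _ =>
      hz z h'.ne'] at this

theorem antisymExt_measurementVector [Fintype E] {k : ℕ} {f : Fin k → Fin n}
    (hf : Function.Injective f) : antisymExt (N.measurementVector k) f =
      (-1) ^ inversionCount f * N.boundaryMeasurement (Finset.univ.image f) :=
  antisymExt_of_injective _ hf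

/-- The boundary measurements of a network in a disk satisfy the Plücker relations. -/
theorem pluckerRelations_measurementVector [Fintype V] [Fintype E] (φ : N.DiskEmbedding) (k : ℕ) :
    PluckerRelations (N.measurementVector k) := by
  classical
  rintro m rfl i j
  by_cases hj : Function.Injective j
  swap
  · exact sum_antisymExt_eq_zero_of_not_injective _ i hj
  by_cases hi : Function.Injective i
  swap
  · refine Finset.sum_eq_zero fun r _ => ?_
    rw [antisymExt_of_not_injective _ (f := Fin.snoc i (j r)), mul_zero, zero_mul]
    exact fun h => hi (Fin.snoc_injective_iff.1 h).1
  set I := Finset.univ.image i with hI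
  set J := Finset.univ.image j with hJ
  have hjJ : ∀ r, j r ∈ J := fun r => Finset.mem_image_of_mem _ (Finset.mem_univ r)
  let s (r : Fin (m + 2)) : ℝ := (-1) ^ (r : ℕ) *
    (-1) ^ inversionCount (Fin.snoc i (j r) : Fin (m + 1) → Fin n) *
      (-1) ^ inversionCount (j ∘ r.succAbove)
  -- The condition `j a.1 ∉ I` discards the terms that vanish because of a repeated index.
  let S : Finset (Fin (m + 2) × Finset E × Finset E) := {a | (N.IsDimer a.2.1 ∧
    N.boundarySubset a.2.1 = insert (j a.1) I) ∧ (N.IsDimer a.2.2 ∧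
    N.boundarySubset a.2.2 = J.erase (j a.1)) ∧ j a.1 ∉ I}
  have hsum : ∑ r : Fin (m + 2), (-1 : ℝ) ^ (r : ℕ)
      * antisymExt (N.measurementVector (m + 1)) (Fin.snoc i (j r) : Fin (m + 1) → Fin n)
      * antisymExt (N.measurementVector (m + 1)) (j ∘ r.succAbove) =
      ∑ a ∈ S, s a.1 * ((∏ e ∈ a.2.1, N.weight e) * ∏ e ∈ a.2.2, N.weight e) := by
    simp only [S]
    rw [Finset.sum_filter, Fintype.sum_prod_type]
    refine Finset.sum_congr rfl fun r _ => ?_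
    by_cases hr : j r ∈ I
    · rw [antisymExt_of_not_injective _ (f := Fin.snoc i (j r)), mul_zero, zero_mul]
      · simp [hr]
      · rwa [Fin.snoc_injective_iff_notMem hi, not_not]
    · rw [antisymExt_measurementVector ((Fin.snoc_injective_iff_notMem hi).2 hr),
        antisymExt_measurementVector (hj.comp Fin.succAbove_right_injective), image_univ_snoc,
        image_univ_succAbove hj, boundaryMeasurement, boundaryMeasurement, ← Finset.sum_filter]
      simp only [hr, not_false_eq_true, and_true]
      have hprod : ({a : Finset E × Finset E | (N.IsDimer a.1 ∧ N.boundarySubset a.1 =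
          insert (j r) I) ∧ N.IsDimer a.2 ∧ N.boundarySubset a.2 = J.erase (j r)} : Finset _) =
          ({P | N.IsDimer P ∧ N.boundarySubset P = insert (j r) I} : Finset (Finset E)) ×ˢ
          ({Q | N.IsDimer Q ∧ N.boundarySubset Q = J.erase (j r)} : Finset (Finset E)) := by
        ext a
        simp
      rw [hprod, ← Finset.mul_sum, Finset.sum_product]
      dsimp only
      rw [← Finset.sum_mul_sum]
      simp only [s]
      ring
  have hidx : ∀ y ∈ J, j (Function.invFun j y) = y := fun y hy => by
    obtain ⟨r, -, h⟩ := Finset.mem_image.1 hy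
    exact Function.invFun_eq ⟨r, h⟩
  rw [hsum]
  refine Finset.sum_involution (fun a _ =>
    (Function.invFun j (N.partner (symmDiff a.2.1 a.2.2) (j a.1)),
      symmDiff a.2.1 (N.component (symmDiff a.2.1 a.2.2) (Sum.inr (j a.1))),
      symmDiff a.2.2 (N.component (symmDiff a.2.1 a.2.2) (Sum.inr (j a.1)))))
    (fun a ha => ?_) (fun a ha _ => ?_) (fun a ha => ?_) (fun a ha => ?_)
  all_goals
    obtain ⟨r, P, Q⟩ := a
    simp only [S, Finset.mem_filter, Finset.mem_univ, true_and] at ha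
    obtain ⟨⟨hP, hPI⟩, ⟨hQ, hQJ⟩, hrI⟩ := ha
    obtain ⟨hne, hyJ, hyI, hPI', hQJ'⟩ := hP.swap_component hQ hPI hQJ hrI (hjJ r)
    have hy := hidx _ hyJ
  · have hodd := hP.odd_sign_exponent φ hQ hPI hQJ hrI (hjJ r)
    simp only [s, plucker_sign hi hj, hy, prod_symmDiff_mul_prod_symmDiff N.weight
      (component_subset (N := N) (D := symmDiff P Q) (c := Sum.inr (j r)))]
    rw [← add_mul, pow_add, pow_add _ (inversionCount i + inversionCount j), ← mul_add,
      ← hI, ← hJ]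
    rw [neg_one_pow_add_neg_one_pow_of_odd hodd]
    ring
  · intro h
    have h1 := congrArg (fun a => j a.1) h
    simp only [hy] at h1
    exact hne h1
  · simp only [S, Finset.mem_filter, Finset.mem_univ, true_and, hy]
    refine ⟨⟨hP.symmDiff_component hQ _, hPI'⟩, ⟨?_, hQJ'⟩, hyI⟩
    rw [symmDiff_comm P Q]
    exact hQ.symmDiff_component hP _
  -- The exchange preserves `symmDiff P Q`, hence also its components and partners, so doing it
  -- twice restores the triple.
  · have hxD : N.edgeAt (j r) ∈ symmDiff P Q := by simp [edgeAt_mem_symmDiff_iff, hPI, hQJ]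
    have hspec := hP.partner_spec hQ hxD
    simp only [hy, symmDiff_symmDiff_component, hP.partner_partner hQ hxD,
      ← component_eq_of_conn hspec.2.2, symmDiff_symmDiff_cancel_right,
      Function.leftInverse_invFun hj r]

end BipartiteNetwork

theorem mainTheorem9 {n k : ℕ} {V E : Type*} [Fintype V] [Fintype E]
    (N : BipartiteNetwork n V E) (φ : N.DiskEmbedding)
    (hweight : ∀ e, 0 ≤ N.weight e)
    (hk : (k : ℤ) = N.rankInt) :
    PluckerRelations (N.measurementVector k) ∧
      N.measurementVector k ∈ tnnGrassmannianCone n k := by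
  have h := BipartiteNetwork.pluckerRelations_measurementVector φ k
  exact ⟨h, h.mem_grassmannianCone,
    fun I => Finset.sum_nonneg fun P _ => Finset.prod_nonneg fun e _ => hweight e⟩
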